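/- **Setting.** An EX-BMDP consists of a finite endogenous state space $\mathcal S$ ($S=|\mathcal S|$), a finite or countable exogenous state space $\Xi$, a finite nonempty action set $\mathcal A$ ($A=|\mathcal A|$), a measurable observation space $\mathcal X$, an initial law $\mu(s)\mu_\xi(\xi)$ and a transition law $T(s'\mid s,a)\,T_\xi(\xi'\mid \xi)$ on latent states $z=(s,\xi)$, and emission laws $q(\cdot\mid z)$ on $\mathcal X$ such that $z$ is a measurable function of the observation almost surely (block property). Let $H\ge 1$ be the horizon. A path to step $h\in[H]=\{1,\dots,H\}$ is a sequence $\upsilon\in\mathcal A^{h-1}$ of actions executed in open loop; $\mathbb P_h(z\mid\upsilon)$ is the resulting law of the latent state at step $h$, and $\mathbb P_h(z\mid\pi)$ is the one under a nonstationary (randomized) policy $\pi=(\pi_t)_t$, $\pi_t:\mathcal X\to\Delta(\mathcal A)$. For a finite set $\Upsilon$ of paths to step $h$, $\mathrm{Unf}(\Upsilon)$ draws $\upsilon\in\Upsilon$ uniformly, executes it, and observes $x$ at step $h$; $\mathbb P_h(\upsilon\mid x,\mathrm{Unf}(\Upsilon))$ is the conditional probability of $\upsilon$ given $x$. Write $\Psi\circ\mathcal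 A$ for the set of paths of $\Psi$ extended by one arbitrary action. *$\eta$-closeness.* A deterministic MDP $\mathcal M_D$ on $\mathcal S,\mathcal A$ (deterministic initial state and transitions $T_D$) is $\eta$-close to the endogenous dynamics if the initial laws, and the laws $T(\cdot\mid s,a)$ and $T_D(\cdot\mid s,a)$ for all $(s,a)$, are at total variation distance at most $\eta$. *Covers.* A set $\Psi_h$ of paths to step $h$ is a minimal policy cover of $\mathcal M_D$ for step $h$ if for every state $s$ reachable at step $h$ in $\mathcal M_D$ there is a unique $\upsilon\in\Psi_h$ with $\mathbb P_h(s\mid\upsilon,T_D)=1$. It is an $\alpha$-approximate policy cover of the EX-BMDP for step $h$ if $\max_{\upsilon\in\Psi_h}\mathbb P_h(z\mid\upsilon)\ge\sup_\pi\mathbb P_h(z\mid\pi)-\alpha$ for all $z=(s,\xi)$, the supremum being over all nonstationary policies. *PPE.* The inputs are a finite class $\mathcal F$ of measurable classifiers $f:\mathcal X\to\Delta(\mathbb N)$, for every finite path set $\Upsilon$ an injective indexing $\mathrm{idx}_\Upsilon:\Upsilon\to\mathbb N$, and a number $N$ of samples per iteration. Start with $\Psi_1=\{()\}$ (the empty path).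 For $h=2,\dots,H$: let $\Upsilon_h=\Psi_{h-1}\circ\mathcal A$; draw fresh i.i.d. samples $(\upsilon^{(n)},x^{(n)})_{n\le N}$ from $\mathrm{Unf}(\Upsilon_h)$; let $\hat f_h\in\mathcal F$ be a maximizer of $\prod_n f(\mathrm{idx}(\upsilon^{(n)})\mid x^{(n)})$ (ties broken measurably); for indices $i<j$ of paths in $\Upsilon_h$ let $\widehat\Delta(i,j)=\frac1N\sum_{n}|\hat f_h(i\mid x^{(n)})-\hat f_h(j\mid x^{(n)})|$, and eliminate the path with index $j$ whenever $\widehat\Delta(i,j)\le\frac{5}{8|\Upsilon_h|}$ for some such $i<j$; $\Psi_h$ is the set of the paths in $\Upsilon_h$ that are not eliminated. *Realizability.* For every $h\in\{2,\dots,H\}$ and every nonempty set $\Psi$ of at most $S$ paths to step $h-1$, with $\Upsilon=\Psi\circ\mathcal A$, there is $f\in\mathcal F$ with $f(\mathrm{idx}_\Upsilon(\upsilon)\mid x)=\mathbb P_h(\upsilon\mid x,\mathrm{Unf}(\Upsilon))$ for all $\upsilon\in\Upsilon$ and almost all $x$. **Theorem (Sample complexity: policy cover with PPE).** There is a universal constant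 $C>0$ such that the following holds. Let an EX-BMDP and a class $\mathcal F$ satisfying realizability be given, and let the deterministic MDP $\mathcal M_D$ be $\eta$-close to the endogenous dynamics, where $\eta\le\frac1{4SH}$. Let $\delta\in(0,1)$ and $N\ge C\,S^2A^2\log\!\big(\tfrac{|\mathcal F|SAH}{\delta}\big)$. Then, with probability greater than $1-\delta$, the sets $\Psi_1,\dots,\Psi_H$ produced by PPE with $N$ samples per iteration satisfy, for every $h\in[H]$: 1. $\Psi_h$ is a minimal policy cover of $\mathcal M_D$ for step $h$; 2. $\Psi_h$ is an $\eta H$-approximate policy cover of the EX-BMDP for step $h$. -/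

import Mathlib

open MeasureTheory Set
open scoped ENNReal

noncomputable section

/-! Time steps are numbered `0, 1, …, H - 1`.  A path is an open-loop policy, that is, a finite list
of actions; a path of length `h` is executed from step `0` and leads to step `h`. -/

/-- Paths carry the discrete σ-algebra. -/
instance instMeasurableSpacePath {A : Type*} : MeasurableSpace (List A) := ⊤

/-- A reward-free Markov decision process with initial law `init` and transition law `trans`;
here it is used for the endogenous dynamics. -/
structure EndoMDP (S A : Type*) where
  init : PMF S
  trans : S → A → PMF S

namespace EndoMDP

variable {S A : Type*}

/-- `P_h(· | υ)`: the law of the state reached by executing the path `υ`, `h = υ.length`. -/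
def pathLaw (M : EndoMDP S A) (υ : List A) : PMF S :=
  υ.foldl (fun p a => p.bind fun s => M.trans s a) M.init

/-- The initial state and all transitions are deterministic. -/
def IsDeterministic (M : EndoMDP S A) : Prop :=
  (∃ s, M.init = PMF.pure s) ∧ ∀ s a, ∃ s', M.trans s a = PMF.pure s'

/-- Total variation distance of two laws on a finite set. -/
def tvDist [Fintype S] (p q : PMF S) : ℝ :=
  (1 / 2) * ∑ s, |(p s).toReal - (q s).toReal|

/-- `M` and `D` are `η`-close: the initial laws, and the transition laws from every state under
every action, are at total variation distance at most `η`. For deterministic `D` with initial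
state `s₀` and successor map `f` this says `M.init s₀ ≥ 1 - η` and
`M.trans s a (f s a) ≥ 1 - η`. -/
def IsClose [Fintype S] (η : ℝ) (M D : EndoMDP S A) : Prop :=
  tvDist M.init D.init ≤ η ∧ ∀ s a, tvDist (M.trans s a) (D.trans s a) ≤ η

/-- The states that can be reached at step `h`. -/
def reachable (M : EndoMDP S A) (h : ℕ) : Set S :=
  {s | ∃ υ : List A, υ.length = h ∧ 0 < M.pathLaw υ s}

/-- `Ψ` is a minimal policy cover for step `h` (of a deterministic MDP): it consists of paths to
step `h`, and each state reachable at step `h` is reached with probability one by a unique path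
in `Ψ`. -/
def IsMinimalPolicyCover (D : EndoMDP S A) (h : ℕ) (Ψ : Finset (List A)) : Prop :=
  (∀ υ ∈ Ψ, υ.length = h) ∧
    ∀ s ∈ D.reachable h, ∃! υ, υ ∈ Ψ ∧ D.pathLaw υ s = 1

end EndoMDP

/-- A (reward-free) exogenous block MDP. The latent state is `z = (s, ξ)`; the endogenous part `s`
evolves by `endo`, the exogenous part `ξ` evolves independently of it and of the actions, and only
an observation `x ∼ emit z` is seen. By the block property the latent state is a function of the
observation (the emission laws have disjoint supports). -/
structure EXBMDP (S Ξ A X : Type*) [MeasurableSpace X] where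
  endo : EndoMDP S A
  exoInit : PMF Ξ
  exoTrans : Ξ → PMF Ξ
  emit : S × Ξ → Measure X
  emit_prob : ∀ z, IsProbabilityMeasure (emit z)
  block : ∃ dec : X → S × Ξ, ∀ z, MeasurableSet (dec ⁻¹' {z}) ∧ emit z (dec ⁻¹' {z}) = 1

/-- A nonstationary policy: at step `t`, after the observation `x`, the action is drawn from
`act t x`. -/
structure NSPolicy (A X : Type*) [MeasurableSpace X] where
  act : ℕ → X → PMF A
  measurable_act : ∀ t a, Measurable fun x => act t x a

namespace EXBMDP

variable {S Ξ A X : Type*} [MeasurableSpace X]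

/-- Initial law of the latent state. -/
def latentInit (M : EXBMDP S Ξ A X) (z : S × Ξ) : ℝ≥0∞ :=
  M.endo.init z.1 * M.exoInit z.2

/-- Transition law of the latent state. -/
def latentTrans (M : EXBMDP S Ξ A X) (z : S × Ξ) (a : A) (z' : S × Ξ) : ℝ≥0∞ :=
  M.endo.trans z.1 a z'.1 * M.exoTrans z.2 z'.2

/-- The probability of the latent state `z` at step `h`, if at step `t` in the latent state `z`
the action `a` is taken with probability `α t z a`. -/
def visit [Fintype A] (M : EXBMDP S Ξ A X) (α : ℕ → S × Ξ → A → ℝ≥0∞) : ℕ → S × Ξ → ℝ≥0∞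
  | 0, z => M.latentInit z
  | t + 1, z' => ∑' z, ∑ a, M.visit α t z * α t z a * M.latentTrans z a z'

/-- `P_h(z | π)` for a nonstationary policy `π` on observations. -/
def policyProb [Fintype A] (M : EXBMDP S Ξ A X) (π : NSPolicy A X) (h : ℕ) (z : S × Ξ) : ℝ≥0∞ :=
  M.visit (fun t z a => ∫⁻ x, π.act t x a ∂M.emit z) h z

open Classical in
/-- `P_h(z | υ)` for a path `υ`, `h = υ.length`. -/
def pathProb [Fintype A] (M : EXBMDP S Ξ A X) (υ : List A) (z : S × Ξ) : ℝ≥0∞ :=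
  M.visit (fun t _ a => if υ[t]? = some a then 1 else 0) υ.length z

/-- `Ψ` is an `α`-approximate policy cover for step `h`: for every latent state `z`,
`max_{υ ∈ Ψ} P_h(z | υ) ≥ sup_π P_h(z | π) - α`, over all nonstationary policies `π`. -/
def IsApproxPolicyCover [Fintype A] (M : EXBMDP S Ξ A X) (α : ℝ) (h : ℕ)
    (Ψ : Finset (List A)) : Prop :=
  (∀ υ ∈ Ψ, υ.length = h) ∧
    ∀ z, ∃ υ ∈ Ψ, ∀ π : NSPolicy A X,
      M.policyProb π h z ≤ M.pathProb υ z + ENNReal.ofReal α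

/-- The law of the observation made after executing the path `υ`. -/
def obsLaw [Fintype A] (M : EXBMDP S Ξ A X) (υ : List A) : Measure X :=
  Measure.sum fun z => M.pathProb υ z • M.emit z

/-- The law of one sample `(υ, x)`: the path `υ` is uniform on `Υ`, and `x` is the observation
made after executing `υ`. -/
def sampleLaw [Fintype A] (M : EXBMDP S Ξ A X) (Υ : Finset (List A)) : Measure (List A × X) :=
  ∑ υ ∈ Υ, (Υ.card : ℝ≥0∞)⁻¹ • (M.obsLaw υ).map fun x => (υ, x)

/-- `f` is the Bayes-optimal inverse dynamics for `Υ`: `f (idx υ | x)` is (a version of) the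
conditional probability of the path `υ` given the observation `x`, for one sample `(υ, x)`. -/
def IsInverseDynamics [Fintype A] (M : EXBMDP S Ξ A X) (Υ : Finset (List A))
    (idx : List A → ℕ) (f : X → PMF ℕ) : Prop :=
  ∀ υ ∈ Υ, ∀ B : Set X, MeasurableSet B →
    ∫⁻ x in B, f x (idx υ) ∂(M.sampleLaw Υ).snd = M.sampleLaw Υ ({υ} ×ˢ B)

end EXBMDP

namespace PPE

variable {A X : Type*}

/-- `Ψ ∘ A`: every path of `Ψ`, extended by every action. -/
def extend [Fintype A] [DecidableEq A] (Ψ : Finset (List A)) : Finset (List A) :=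
  (Ψ ×ˢ Finset.univ).image fun p => p.1 ++ [p.2]

/-- Likelihood of the classifier `f` on the data `D`. -/
def likelihood {N : ℕ} (idx : List A → ℕ) (f : X → PMF ℕ) (D : Fin N → List A × X) : ℝ≥0∞ :=
  ∏ n, f (D n).2 (idx (D n).1)

/-- `mle Υ D` is a maximum likelihood classifier in the class `F` on every data set `D` for the
path set `Υ`. Ties may be broken in any measurable way. -/
def IsMLE [MeasurableSpace X] {N : ℕ} (F : Finset (X → PMF ℕ))
    (idx : Finset (List A) → List A → ℕ)
    (mle : Finset (List A) → (Fin N → List A × X) → X → PMF ℕ) : Prop :=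
  ∀ Υ, (∀ D, mle Υ D ∈ F ∧
      ∀ f ∈ F, likelihood (idx Υ) f D ≤ likelihood (idx Υ) (mle Υ D) D) ∧
    ∀ f ∈ F, MeasurableSet {D | mle Υ D = f}

/-- Empirical path prediction gap of the labels `i` and `j`. -/
def gap {N : ℕ} (f : X → PMF ℕ) (D : Fin N → List A × X) (i j : ℕ) : ℝ :=
  (1 / N) * ∑ n, |(f (D n).2 i).toReal - (f (D n).2 j).toReal|

open Classical in
/-- The elimination step: for each pair of paths with indices `i < j` and gap at most
`5 / (8 |Υ|)`, the path with index `j` is removed. -/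
def eliminate {N : ℕ} (idx : List A → ℕ) (f : X → PMF ℕ) (Υ : Finset (List A))
    (D : Fin N → List A × X) : Finset (List A) :=
  Υ.filter fun υ => ¬ ∃ υ' ∈ Υ, idx υ' < idx υ ∧
    gap f D (idx υ') (idx υ) ≤ 5 / (8 * (Υ.card : ℝ))

/-- The law of the path set that one iteration of PPE computes from the path set `Υ`: a fresh data
set `D` of `N` i.i.d. samples is drawn, the classifier is fitted on `D` by maximum likelihood, and
paths of `Υ` are eliminated. -/
def iterationLaw {S Ξ : Type*} [MeasurableSpace X] [Fintype A]
    (M : EXBMDP S Ξ A X) {N : ℕ} (idx : Finset (List A) → List A → ℕ)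
    (mle : Finset (List A) → (Fin N → List A × X) → X → PMF ℕ) (Υ : Finset (List A)) :
    Measure (Finset (List A)) :=
  (Measure.pi fun _ : Fin N => M.sampleLaw Υ).map fun D => eliminate (idx Υ) (mle Υ D) Υ D

/-- The joint law of the path sets `Ψ 0, Ψ 1, …, Ψ n` computed by PPE in `n` iterations with `N`
samples each (later entries are irrelevant). It starts with `Ψ 0 = {[]}`, and, given
`Ψ 0, …, Ψ n`, the path set `Ψ (n + 1)` is computed by one iteration from `extend (Ψ n)`. -/
def law {S Ξ : Type*} [MeasurableSpace X] [Fintype A] [DecidableEq A]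
    (M : EXBMDP S Ξ A X) {N : ℕ} (idx : Finset (List A) → List A → ℕ)
    (mle : Finset (List A) → (Fin N → List A × X) → X → PMF ℕ) :
    ℕ → Measure (ℕ → Finset (List A))
  | 0 => Measure.dirac fun _ => {[]}
  | n + 1 => (law M idx mle n).bind fun Ψ =>
      (iterationLaw M idx mle (extend (Ψ n))).map (Function.update Ψ (n + 1))

end PPE

end

noncomputable section

/-! ### Deterministic dynamics and their perturbations -/

namespace EndoMDP

variable {S A : Type*}

/-! In `D` every path leads to a single state, and in the true dynamics it misses that state with
probability at most `η` for the initial draw plus `η` per transition, hence at most `1 / 4` for all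
paths considered. Under open-loop control the latent law is a product of the endogenous path law and
an exogenous law that does not depend on the actions. By Bayes' rule the density `f (idx υ | x)` of
the inverse dynamics, integrated against the law of `x`, is the observation law of `υ` divided by `κ
= |Υ|`. The mean gap of two paths is therefore `2 / κ` times the total variation distance of their
observation laws: at most `1 / (2κ)` if they share their state in `D` (`integral_gap_le`), at least
`1 / κ` if not (`le_integral_gap`, by the block property). Estimating all gaps within `1 / (8κ)`
makes the threshold `5 / (8κ)` decide correctly.

The gap of the fitted classifier is measured on its own training data, so an in-sample guarantee is
what is needed. The square root of the likelihood ratio against the Bayes classifier, weighted by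
`exp (1 - affinity)`, has mean at most one. Markov's inequality and a union bound over `F` then
bound the empirical sum of `1 - affinity` for every classifier that is at least as likely
(`measure_likelihood_le_and_le_sum_le`). This sum controls the difference of the empirical gaps
(`sq_gap_sub_gap_le`), and Hoeffding's inequality handles the Bayes classifier itself
(`measure_exists_lt_abs_gap_sub_le`).

When the test is correct, elimination keeps the path of least index for each state of `D`, so a
minimal cover yields the next one. A minimal cover has at most `S` paths, so realizability applies
again. The iterations are chained by `pow_le_law`, each failing with probability at most `δ / H`.

The second claim follows from the first without statistics: no policy influences the exogenous
marginal, and any policy leaves the states reachable in `D` with probability at most `η` per random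
draw. -/

theorem pathLaw_concat (M : EndoMDP S A) (υ : List A) (a : A) :
    M.pathLaw (υ ++ [a]) = (M.pathLaw υ).bind fun s => M.trans s a := by
  simp [pathLaw]

theorem IsDeterministic.exists_pathLaw_eq_pure {D : EndoMDP S A} (hD : D.IsDeterministic)
    (υ : List A) : ∃ s, D.pathLaw υ = PMF.pure s := by
  induction υ using List.reverseRecOn with
  | nil => exact hD.1
  | append_singleton υ a ih =>
    obtain ⟨s, hs⟩ := ih
    obtain ⟨s', hs'⟩ := hD.2 s a
    exact ⟨s', by rw [pathLaw_concat, hs, PMF.pure_bind, hs']⟩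

theorem pure_apply_eq_one_iff {s s' : S} : PMF.pure s s' = 1 ↔ PMF.pure s = PMF.pure s' := by
  classical
  constructor
  · intro h
    by_cases hs : s' = s
    · rw [hs]
    · simp [PMF.pure_apply, hs] at h
  · intro h
    rw [h]
    simp

/-- A path of a deterministic MDP leads to a single state. -/
theorem IsDeterministic.pathLaw_eq_one_iff {D : EndoMDP S A} (hD : D.IsDeterministic)
    (υ : List A) (s : S) : D.pathLaw υ s = 1 ↔ D.pathLaw υ = PMF.pure s := by
  obtain ⟨s', hs'⟩ := hD.exists_pathLaw_eq_pure υ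
  rw [hs', pure_apply_eq_one_iff]

theorem IsDeterministic.mem_reachable_iff {D : EndoMDP S A} (hD : D.IsDeterministic)
    {h : ℕ} {s : S} : s ∈ D.reachable h ↔ ∃ υ : List A, υ.length = h ∧ D.pathLaw υ = PMF.pure s := by
  constructor
  · rintro ⟨υ, hυ, hs⟩
    obtain ⟨s', hs'⟩ := hD.exists_pathLaw_eq_pure υ
    refine ⟨υ, hυ, ?_⟩
    rw [hs'] at hs ⊢
    classical
    by_contra hne
    rw [PMF.pure_apply, if_neg (fun h => hne (by rw [h]))] at hs
    exact lt_irrefl _ hs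
  · rintro ⟨υ, hυ, hs⟩
    exact ⟨υ, hυ, by simp [hs]⟩

theorem toReal_le_one (p : PMF S) (s : S) : (p s).toReal ≤ 1 :=
  ENNReal.toReal_le_of_le_ofReal zero_le_one (by simpa using p.coe_le_one s)

variable [Fintype S]

theorem sum_toReal_eq_one (p : PMF S) : ∑ s, (p s).toReal = 1 := by
  rw [← ENNReal.toReal_sum (fun s _ => p.apply_ne_top s), ← tsum_fintype (L := .unconditional S),
    p.tsum_coe, ENNReal.toReal_one]

theorem sum_apply_eq_one (p : PMF S) : ∑ s, p s = 1 := by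
  rw [← tsum_fintype (L := .unconditional S), p.tsum_coe]

theorem tvDist_nonneg (p q : PMF S) : 0 ≤ tvDist p q := by
  unfold tvDist; positivity

/-- The distance to a point mass is exactly the mass missing at that point; only this inequality is
used. -/
theorem one_sub_tvDist_pure_le (p : PMF S) (s : S) :
    1 - tvDist p (PMF.pure s) ≤ (p s).toReal := by
  classical
  have h1 := sum_toReal_eq_one p
  rw [← Finset.add_sum_erase _ _ (Finset.mem_univ s)] at h1
  have h2 : ∑ x ∈ Finset.univ.erase s, |(p x).toReal - (PMF.pure s x).toReal|
      = ∑ x ∈ Finset.univ.erase s, (p x).toReal := by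
    refine Finset.sum_congr rfl fun x hx => ?_
    rw [PMF.pure_apply, if_neg (Finset.ne_of_mem_erase hx)]
    simp
  have h3 := neg_abs_le ((p s).toReal - (PMF.pure s s).toReal)
  have h4 : (PMF.pure s s).toReal = 1 := by simp
  rw [h4] at h3
  have h5 := abs_of_nonpos (sub_nonpos.2 (toReal_le_one p s))
  rw [tvDist, ← Finset.add_sum_erase _ _ (Finset.mem_univ s), h2, h4, h5]
  linarith

theorem IsClose.nonneg {M D : EndoMDP S A} {η : ℝ} (hc : IsClose η M D) : 0 ≤ η :=
  (tvDist_nonneg _ _).trans hc.1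

/-- Union bound over the initial draw and the `υ.length` transitions, which accounts for the factor
`υ.length + 1`. -/
theorem IsClose.one_sub_le_pathLaw {M D : EndoMDP S A} {η : ℝ} (hc : IsClose η M D)
    (hD : D.IsDeterministic) (υ : List A) {s : S} (hs : D.pathLaw υ = PMF.pure s) :
    1 - (υ.length + 1) * η ≤ (M.pathLaw υ s).toReal := by
  induction υ using List.reverseRecOn generalizing s with
  | nil =>
    have h1 := one_sub_tvDist_pure_le M.init s
    have h2 := hc.1
    have h3 : D.init = PMF.pure s := hs
    rw [h3] at h2
    simp only [List.length_nil, Nat.cast_zero, zero_add, one_mul]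
    exact (by linarith : 1 - η ≤ _).trans h1
  | append_singleton υ a ih =>
    obtain ⟨s₀, hs₀⟩ := hD.exists_pathLaw_eq_pure υ
    rw [pathLaw_concat, hs₀, PMF.pure_bind] at hs
    have h1 := ih hs₀
    have h2 := one_sub_tvDist_pure_le (M.trans s₀ a) s
    have h3 := hc.2 s₀ a
    rw [hs] at h3
    have h4 : (M.pathLaw υ s₀ * M.trans s₀ a s).toReal ≤ (M.pathLaw (υ ++ [a]) s).toReal := by
      refine ENNReal.toReal_mono (PMF.apply_ne_top _ _) ?_
      rw [pathLaw_concat, PMF.bind_apply]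
      exact ENNReal.le_tsum (f := fun x => M.pathLaw υ x * M.trans x a s) s₀
    rw [ENNReal.toReal_mul] at h4
    -- From `(1 - p) * (1 - q) ≥ 0` follows `p * q ≥ p + q - 1`, so the failure probabilities add
    -- up.
    have h5 := mul_nonneg (sub_nonneg.2 (toReal_le_one (M.pathLaw υ) s₀))
      (sub_nonneg.2 (toReal_le_one (M.trans s₀ a) s))
    simp only [List.length_append, List.length_singleton, Nat.cast_add, Nat.cast_one]
    nlinarith

end EndoMDP

/-! ### Latent occupancies and approximate covers -/

namespace EXBMDP

variable {S Ξ A X : Type*} [MeasurableSpace X]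

/-- The law of the exogenous state. -/
def exoLaw (M : EXBMDP S Ξ A X) : ℕ → PMF Ξ
  | 0 => M.exoInit
  | t + 1 => (exoLaw M t).bind M.exoTrans

variable [Fintype A]

/-- Open-loop actions ignore the observations, so the endogenous and exogenous parts stay
independent. This fails for general policies, for which only `sum_visit_le` is available. -/
theorem pathProb_eq (M : EXBMDP S Ξ A X) (υ : List A) (s : S) (ξ : Ξ) :
    M.pathProb υ (s, ξ) = M.endo.pathLaw υ s * M.exoLaw υ.length ξ := by
  classical
  have key : ∀ t ≤ υ.length, ∀ s ξ,
      M.visit (fun t _ a => if υ[t]? = some a then 1 else 0) t (s, ξ)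
        = M.endo.pathLaw (υ.take t) s * M.exoLaw t ξ := by
    intro t
    induction t with
    | zero => intro _ s ξ; simp [visit, latentInit, exoLaw, EndoMDP.pathLaw]
    | succ t ih =>
      intro ht s ξ
      have ht' : t < υ.length := ht
      rw [visit, List.take_add_one, List.getElem?_eq_getElem ht', Option.toList_some,
        EndoMDP.pathLaw_concat, exoLaw, PMF.bind_apply, PMF.bind_apply, ENNReal.tsum_prod',
        ← ENNReal.tsum_mul_right]
      refine tsum_congr fun s₀ => ?_
      rw [← ENNReal.tsum_mul_left]
      refine tsum_congr fun ξ₀ => ?_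
      rw [Finset.sum_eq_single υ[t]]
      · rw [ih ht'.le]
        simp only [if_true, latentTrans]
        ring
      · intro b _ hb
        rw [if_neg (fun h => hb (Option.some.inj h).symm)]
        simp
      · simp
  have := key υ.length le_rfl s ξ
  rwa [List.take_length] at this

theorem sum_lintegral_act_le_one (M : EXBMDP S Ξ A X) (π : NSPolicy A X) (t : ℕ) (z : S × Ξ) :
    ∑ a, ∫⁻ x, π.act t x a ∂M.emit z ≤ 1 := by
  have := M.emit_prob z
  rw [← lintegral_finsetSum _ fun a _ => π.measurable_act t a]
  simp [EndoMDP.sum_apply_eq_one]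

variable [Fintype S]

/-- Actions never affect the exogenous part, so summing out the endogenous state leaves a quantity
that no policy can increase. Subprobability action weights suffice. -/
theorem sum_visit_le (M : EXBMDP S Ξ A X) {α : ℕ → S × Ξ → A → ℝ≥0∞}
    (hα : ∀ t z, ∑ a, α t z a ≤ 1) (t : ℕ) (ξ : Ξ) :
    ∑ s, M.visit α t (s, ξ) ≤ M.exoLaw t ξ := by
  induction t generalizing ξ with
  | zero =>
    simp only [visit, latentInit, exoLaw, ← Finset.sum_mul, EndoMDP.sum_apply_eq_one, one_mul,
      le_refl]
  | succ t ih =>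
    simp only [visit, latentTrans]
    rw [← tsum_fintype (L := .unconditional S), ENNReal.tsum_comm, exoLaw, PMF.bind_apply]
    calc ∑' (z : S × Ξ) (s : S), ∑ a, M.visit α t z * α t z a *
            (M.endo.trans z.1 a s * M.exoTrans z.2 ξ)
        ≤ ∑' z : S × Ξ, M.visit α t z * M.exoTrans z.2 ξ := by
          refine ENNReal.tsum_le_tsum fun z => ?_
          rw [tsum_fintype, Finset.sum_comm]
          calc ∑ a, ∑ s, M.visit α t z * α t z a * (M.endo.trans z.1 a s * M.exoTrans z.2 ξ)
              = ∑ a, α t z a * (M.visit α t z * M.exoTrans z.2 ξ) := by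
                refine Finset.sum_congr rfl fun a _ => ?_
                rw [← Finset.mul_sum, ← Finset.sum_mul, EndoMDP.sum_apply_eq_one]
                ring
            _ ≤ _ := by
                rw [← Finset.sum_mul]
                exact mul_le_of_le_one_left' (hα t z)
      _ = ∑' ξ₀, (∑ s, M.visit α t (s, ξ₀)) * M.exoTrans ξ₀ ξ := by
          rw [ENNReal.tsum_prod', ENNReal.tsum_comm]
          refine tsum_congr fun ξ₀ => ?_
          rw [tsum_fintype, Finset.sum_mul]
      _ ≤ _ := ENNReal.tsum_le_tsum fun ξ₀ => mul_le_mul_left (ih ξ₀) _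

theorem tsum_visit_le_one (M : EXBMDP S Ξ A X) {α : ℕ → S × Ξ → A → ℝ≥0∞}
    (hα : ∀ t z, ∑ a, α t z a ≤ 1) (t : ℕ) : ∑' z, M.visit α t z ≤ 1 := by
  rw [ENNReal.tsum_prod', ENNReal.tsum_comm, ← (M.exoLaw t).tsum_coe]
  refine ENNReal.tsum_le_tsum fun ξ => ?_
  rw [tsum_fintype]
  exact M.sum_visit_le hα t ξ

/-- Law of the endogenous state outside the support of a close deterministic law. -/
theorem _root_.EndoMDP.sum_compl_le {p q : PMF S} {η : ℝ} (h : EndoMDP.tvDist p q ≤ η) {s : S}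
    (hq : q = PMF.pure s) {c : S → ℝ≥0∞} (hc1 : ∀ s, c s ≤ 1) (hc : c s = 0) :
    ∑ s', p s' * c s' ≤ ENNReal.ofReal η := by
  classical
  have h1 := EndoMDP.one_sub_tvDist_pure_le p s
  rw [hq] at h
  have h2 := EndoMDP.sum_toReal_eq_one p
  rw [← Finset.add_sum_erase _ _ (Finset.mem_univ s)] at h2
  calc ∑ s', p s' * c s' ≤ ∑ s' ∈ Finset.univ.erase s, p s' := by
        rw [← Finset.add_sum_erase _ _ (Finset.mem_univ s), hc, mul_zero, zero_add]
        exact Finset.sum_le_sum fun x _ => mul_le_of_le_one_right' (hc1 x)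
    _ ≤ ENNReal.ofReal η := by
        rw [← ENNReal.ofReal_toReal (a := ∑ s' ∈ Finset.univ.erase s, p s')
          (ENNReal.sum_ne_top.2 fun x _ => p.apply_ne_top x),
          ENNReal.toReal_sum fun x _ => p.apply_ne_top x]
        exact ENNReal.ofReal_le_ofReal (by linarith)

-- To be outside the reachable set of `D`, the process must have been outside before, or the last
-- draw must have deviated from `D`, which has probability at most `η`. Induction adds up one `η`
-- for each of the `t + 1` draws.
open Classical in
theorem tsum_visit_unreachable_le (M : EXBMDP S Ξ A X) {D : EndoMDP S A}
    (hD : D.IsDeterministic) {η : ℝ} (hc : EndoMDP.IsClose η M.endo D)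
    {α : ℕ → S × Ξ → A → ℝ≥0∞} (hα : ∀ t z, ∑ a, α t z a ≤ 1) (t : ℕ) :
    ∑' z : S × Ξ, M.visit α t z * (if z.1 ∈ D.reachable t then 0 else 1)
      ≤ (t + 1) * ENNReal.ofReal η := by
  induction t with
  | zero =>
    simp only [visit, latentInit]
    rw [ENNReal.tsum_prod']
    obtain ⟨s, hs⟩ := hD.1
    have h0 : s ∈ D.reachable 0 := hD.mem_reachable_iff.2 ⟨[], rfl, hs⟩
    calc ∑' (s : S) (ξ : Ξ), M.endo.init s * M.exoInit ξ * (if s ∈ D.reachable 0 then 0 else 1)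
        = ∑ s, M.endo.init s * (if s ∈ D.reachable 0 then 0 else 1) := by
          rw [tsum_fintype]
          refine Finset.sum_congr rfl fun s _ => ?_
          rw [ENNReal.tsum_mul_right, ENNReal.tsum_mul_left, PMF.tsum_coe, mul_one]
      _ ≤ ENNReal.ofReal η := EndoMDP.sum_compl_le hc.1 hs
          (fun s => by split_ifs <;> simp) (by simp [h0])
      _ = _ := by simp
  | succ t ih =>
    have step : ∀ s a, ∑ s', M.endo.trans s a s' *
        (if s' ∈ D.reachable (t + 1) then 0 else 1 : ℝ≥0∞)
        ≤ ENNReal.ofReal η + (if s ∈ D.reachable t then 0 else 1) := by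
      intro s a
      split_ifs with hs
      · rw [add_zero]
        obtain ⟨s', hs'⟩ := hD.2 s a
        obtain ⟨υ, hυ, hυs⟩ := hD.mem_reachable_iff.1 hs
        have : s' ∈ D.reachable (t + 1) := hD.mem_reachable_iff.2
          ⟨υ ++ [a], by simp [hυ], by rw [EndoMDP.pathLaw_concat, hυs, PMF.pure_bind, hs']⟩
        exact EndoMDP.sum_compl_le (hc.2 s a) hs' (fun s => by split_ifs <;> simp) (by simp [this])
      · refine le_add_left ?_
        refine le_of_le_of_eq ?_ (EndoMDP.sum_apply_eq_one (M.endo.trans s a))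
        exact Finset.sum_le_sum fun x _ => mul_le_of_le_one_right' (by split_ifs <;> simp)
    calc ∑' z : S × Ξ, M.visit α (t + 1) z * (if z.1 ∈ D.reachable (t + 1) then 0 else 1)
        = ∑' (z₀ : S × Ξ) (z : S × Ξ), ∑ a, M.visit α t z₀ * α t z₀ a *
            ((M.endo.trans z₀.1 a z.1 * (if z.1 ∈ D.reachable (t + 1) then 0 else 1)) *
              M.exoTrans z₀.2 z.2) := by
          simp only [visit, latentTrans]
          rw [ENNReal.tsum_comm]
          refine tsum_congr fun z => ?_
          rw [← ENNReal.tsum_mul_right]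
          refine tsum_congr fun z₀ => ?_
          rw [Finset.sum_mul]
          refine Finset.sum_congr rfl fun a _ => ?_
          ring
      _ = ∑' z₀ : S × Ξ, ∑ a, M.visit α t z₀ * α t z₀ a *
            ∑ s, M.endo.trans z₀.1 a s * (if s ∈ D.reachable (t + 1) then 0 else 1) := by
          refine tsum_congr fun z₀ => ?_
          rw [Summable.tsum_finsetSum fun _ _ => ENNReal.summable]
          refine Finset.sum_congr rfl fun a _ => ?_
          rw [ENNReal.tsum_mul_left, ENNReal.tsum_prod', tsum_fintype]
          congr 1
          refine Finset.sum_congr rfl fun s _ => ?_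
          exact (ENNReal.tsum_mul_left (f := M.exoTrans z₀.2) (a := M.endo.trans z₀.1 a s *
            (if s ∈ D.reachable (t + 1) then 0 else 1))).trans (by rw [PMF.tsum_coe, mul_one])
      _ ≤ ∑' z₀ : S × Ξ, M.visit α t z₀ *
            (ENNReal.ofReal η + (if z₀.1 ∈ D.reachable t then 0 else 1)) := by
          refine ENNReal.tsum_le_tsum fun z₀ => ?_
          calc ∑ a, M.visit α t z₀ * α t z₀ a *
                ∑ s, M.endo.trans z₀.1 a s * (if s ∈ D.reachable (t + 1) then 0 else 1)
              ≤ ∑ a, α t z₀ a * (M.visit α t z₀ *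
                  (ENNReal.ofReal η + (if z₀.1 ∈ D.reachable t then 0 else 1))) := by
                refine Finset.sum_le_sum fun a _ => ?_
                calc _ ≤ M.visit α t z₀ * α t z₀ a *
                      (ENNReal.ofReal η + (if z₀.1 ∈ D.reachable t then 0 else 1)) :=
                      mul_le_mul_right (step _ _) _
                  _ = _ := by ring
            _ ≤ _ := by
                rw [← Finset.sum_mul]
                exact mul_le_of_le_one_left' (hα t z₀)
      _ ≤ ENNReal.ofReal η + (t + 1) * ENNReal.ofReal η := by
          simp only [mul_add]
          rw [ENNReal.tsum_add, ENNReal.tsum_mul_right]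
          exact add_le_add (mul_le_of_le_one_left' (M.tsum_visit_le_one hα t)) ih
      _ = _ := by push_cast; ring

/-- A minimal policy cover of a close deterministic MDP is an approximate policy cover. -/
theorem isApproxPolicyCover_of_isMinimalPolicyCover (M : EXBMDP S Ξ A X) [Nonempty A]
    {D : EndoMDP S A} (hD : D.IsDeterministic) {η : ℝ} (hc : EndoMDP.IsClose η M.endo D)
    {h H : ℕ} (hH : h < H) {Ψ : Finset (List A)} (hΨ : D.IsMinimalPolicyCover h Ψ) :
    M.IsApproxPolicyCover (η * H) h Ψ := by
  classical
  have hη := hc.nonneg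
  have hhH : (h : ℝ) + 1 ≤ H := by exact_mod_cast hH
  refine ⟨hΨ.1, ?_⟩
  rintro ⟨s, ξ⟩
  by_cases hs : s ∈ D.reachable h
  · obtain ⟨υ, ⟨hυ, hυs⟩, -⟩ := hΨ.2 s hs
    refine ⟨υ, hυ, fun π => ?_⟩
    have hlen := hΨ.1 υ hυ
    have h1 := hc.one_sub_le_pathLaw hD υ ((hD.pathLaw_eq_one_iff υ s).1 hυs)
    rw [hlen] at h1
    -- Both the policy bound and the path probability carry the factor `M.exoLaw h ξ`, so it is
    -- enough to compare the endogenous factors.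
    have h2 : 1 ≤ M.endo.pathLaw υ s + ENNReal.ofReal (η * H) := by
      rw [← ENNReal.ofReal_toReal (PMF.apply_ne_top (M.endo.pathLaw υ) s),
        ← ENNReal.ofReal_add ENNReal.toReal_nonneg (by positivity), ← ENNReal.ofReal_one]
      exact ENNReal.ofReal_le_ofReal (by nlinarith)
    calc M.policyProb π h (s, ξ)
        ≤ ∑ s, M.policyProb π h (s, ξ) :=
          Finset.single_le_sum (f := fun s => M.policyProb π h (s, ξ)) (fun _ _ => zero_le)
            (Finset.mem_univ s)
      _ ≤ M.exoLaw h ξ := M.sum_visit_le (fun t z => M.sum_lintegral_act_le_one π t z) h ξ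
      _ ≤ (M.endo.pathLaw υ s + ENNReal.ofReal (η * H)) * M.exoLaw h ξ :=
          le_mul_of_one_le_left' h2
      _ ≤ M.pathProb υ (s, ξ) + ENNReal.ofReal (η * H) := by
          rw [add_mul, pathProb_eq, hlen]
          exact add_le_add_right (mul_le_of_le_one_right' (PMF.coe_le_one _ _)) _
  -- For an unreachable state the error term alone dominates every policy, so any path of the cover
  -- serves; one exists because some state is reachable.
  · obtain ⟨a⟩ := ‹Nonempty A›
    obtain ⟨s', hs'⟩ := hD.exists_pathLaw_eq_pure (List.replicate h a)
    obtain ⟨υ, ⟨hυ, -⟩, -⟩ := hΨ.2 s' (hD.mem_reachable_iff.2 ⟨_, by simp, hs'⟩)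
    refine ⟨υ, hυ, fun π => le_add_left ?_⟩
    have h1 := M.tsum_visit_unreachable_le hD hc
      (fun t z => M.sum_lintegral_act_le_one π t z) h
    calc M.policyProb π h (s, ξ)
        = M.policyProb π h (s, ξ) * (if s ∈ D.reachable h then 0 else 1) := by simp [hs]
      _ ≤ _ := ENNReal.le_tsum (f := fun z : S × Ξ => M.policyProb π h z *
            (if z.1 ∈ D.reachable h then 0 else 1)) (s, ξ)
      _ ≤ _ := h1
      _ = ENNReal.ofReal ((h + 1) * η) := by
          rw [ENNReal.ofReal_mul (by positivity)]
          congr 1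
          rw [ENNReal.ofReal_add (by positivity) zero_le_one]
          simp
      _ ≤ _ := ENNReal.ofReal_le_ofReal (by nlinarith)

end EXBMDP

/-! ### The mean gap as a total variation distance -/

/-- As the total masses agree, `B` and its complement have the same excess up to sign, whence the
factor `2`. -/
theorem integral_abs_sub_ge {Ω : Type*} [MeasurableSpace Ω] {μ : Measure Ω} {p q : Ω → ℝ}
    (hp : Integrable p μ) (hq : Integrable q μ) {B : Set Ω} (hB : MeasurableSet B)
    (hpq : ∫ x, p x ∂μ = ∫ x, q x ∂μ) :
    2 * ((∫ x in B, p x ∂μ) - ∫ x in B, q x ∂μ) ≤ ∫ x, |p x - q x| ∂μ := by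
  have h1 := integral_add_compl hB hp
  have h2 := integral_add_compl hB hq
  have h0 := integral_add_compl hB (hp.sub hq).abs
  simp only [Pi.sub_apply] at h0
  rw [← h0]
  have h3 : (∫ x in B, p x ∂μ) - ∫ x in B, q x ∂μ ≤ ∫ x in B, |p x - q x| ∂μ := by
    rw [← integral_sub hp.integrableOn hq.integrableOn]
    exact integral_mono (hp.sub hq).integrableOn (hp.sub hq).abs.integrableOn
      fun x => le_abs_self _
  have h4 : (∫ x in Bᶜ, q x ∂μ) - ∫ x in Bᶜ, p x ∂μ ≤ ∫ x in Bᶜ, |p x - q x| ∂μ := by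
    rw [← integral_sub hq.integrableOn hp.integrableOn]
    refine integral_mono (hq.sub hp).integrableOn (hp.sub hq).abs.integrableOn fun x => ?_
    change q x - p x ≤ |p x - q x|
    rw [abs_sub_comm]
    exact le_abs_self _
  linarith

/-- The set where `q < p` attains the bound of `integral_abs_sub_ge`. -/
theorem exists_integral_abs_sub_le {Ω : Type*} [MeasurableSpace Ω] {μ : Measure Ω} {p q : Ω → ℝ}
    (hpm : Measurable p) (hqm : Measurable q)
    (hp : Integrable p μ) (hq : Integrable q μ) (hpq : ∫ x, p x ∂μ = ∫ x, q x ∂μ) :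
    ∃ B, MeasurableSet B ∧
      ∫ x, |p x - q x| ∂μ ≤ 2 * ((∫ x in B, p x ∂μ) - ∫ x in B, q x ∂μ) := by
  have hB : MeasurableSet {x | q x < p x} := measurableSet_lt hqm hpm
  refine ⟨_, hB, ?_⟩
  have h1 := integral_add_compl hB hp
  have h2 := integral_add_compl hB hq
  have h0 := integral_add_compl hB (hp.sub hq).abs
  simp only [Pi.sub_apply] at h0
  rw [← h0]
  have h3 : ∫ x in {x | q x < p x}, |p x - q x| ∂μ
      = (∫ x in {x | q x < p x}, p x ∂μ) - ∫ x in {x | q x < p x}, q x ∂μ := by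
    rw [← integral_sub hp.integrableOn hq.integrableOn]
    refine setIntegral_congr_fun hB fun x hx => abs_of_nonneg ?_
    exact sub_nonneg.2 (le_of_lt hx)
  have h4 : ∫ x in {x | q x < p x}ᶜ, |p x - q x| ∂μ
      = (∫ x in {x | q x < p x}ᶜ, q x ∂μ) - ∫ x in {x | q x < p x}ᶜ, p x ∂μ := by
    rw [← integral_sub hq.integrableOn hp.integrableOn]
    refine setIntegral_congr_fun hB.compl fun x hx => ?_
    have hx' : p x ≤ q x := not_lt.1 hx
    change |p x - q x| = q x - p x
    rw [abs_of_nonpos (by linarith)]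
    ring
  linarith

namespace EXBMDP

variable {S Ξ A X : Type*} [MeasurableSpace X]

/-- The law of the observation at step `t`, given the endogenous state `s`. -/
def obsGiven (M : EXBMDP S Ξ A X) (t : ℕ) (s : S) : Measure X :=
  Measure.sum fun ξ => M.exoLaw t ξ • M.emit (s, ξ)

instance (M : EXBMDP S Ξ A X) (t : ℕ) (s : S) : IsProbabilityMeasure (M.obsGiven t s) := by
  constructor
  have := M.emit_prob
  rw [obsGiven, Measure.sum_apply _ MeasurableSet.univ]
  simp [PMF.tsum_coe]

variable [Fintype A]

theorem obsLaw_apply [Fintype S] (M : EXBMDP S Ξ A X) (υ : List A) {B : Set X}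
    (hB : MeasurableSet B) :
    M.obsLaw υ B = ∑ s, M.endo.pathLaw υ s * M.obsGiven υ.length s B := by
  rw [obsLaw, Measure.sum_apply _ hB, ENNReal.tsum_prod', tsum_fintype]
  refine Finset.sum_congr rfl fun s _ => ?_
  rw [obsGiven, Measure.sum_apply _ hB, ← ENNReal.tsum_mul_left]
  refine tsum_congr fun ξ => ?_
  simp only [pathProb_eq, Measure.smul_apply, smul_eq_mul, mul_assoc]

instance [Fintype S] (M : EXBMDP S Ξ A X) (υ : List A) : IsProbabilityMeasure (M.obsLaw υ) := by
  constructor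
  rw [obsLaw_apply _ _ MeasurableSet.univ]
  simp [EndoMDP.sum_apply_eq_one]

theorem obsLaw_real_apply [Fintype S] (M : EXBMDP S Ξ A X) (υ : List A) {B : Set X}
    (hB : MeasurableSet B) :
    (M.obsLaw υ).real B =
      ∑ s, (M.endo.pathLaw υ s).toReal * (M.obsGiven υ.length s).real B := by
  rw [Measure.real, obsLaw_apply _ _ hB, ENNReal.toReal_sum]
  · simp [Measure.real]
  · exact fun s _ => ENNReal.mul_ne_top (PMF.apply_ne_top _ _) (measure_ne_top _ _)

/-- By the block property, the endogenous state is a function of the observation. -/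
theorem exists_obsLaw_eq_pathLaw [Fintype S] [Countable Ξ] (M : EXBMDP S Ξ A X) (s : S) :
    ∃ B, MeasurableSet B ∧ ∀ υ, M.obsLaw υ B = M.endo.pathLaw υ s := by
  classical
  obtain ⟨dec, hdec⟩ := M.block
  have hB : MeasurableSet (⋃ ξ, dec ⁻¹' {(s, ξ)}) := MeasurableSet.iUnion fun ξ => (hdec _).1
  refine ⟨_, hB, fun υ => ?_⟩
  have key : ∀ s' ξ, M.emit (s', ξ) (⋃ ξ, dec ⁻¹' {(s, ξ)}) = if s' = s then 1 else 0 := by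
    intro s' ξ
    have := M.emit_prob (s', ξ)
    split_ifs with hs
    · subst hs
      refine le_antisymm prob_le_one ?_
      rw [← (hdec (s', ξ)).2]
      exact measure_mono (subset_iUnion (fun ξ => dec ⁻¹' {(s', ξ)}) ξ)
    · refine measure_mono_null ?_ ((prob_compl_eq_zero_iff (hdec (s', ξ)).1).2 (hdec (s', ξ)).2)
      intro x hx hx'
      obtain ⟨ξ', hξ'⟩ := mem_iUnion.1 hx
      exact hs (congrArg Prod.fst ((mem_singleton_iff.1 hx').symm.trans hξ'))
  have key' : ∀ s', M.obsGiven υ.length s' (⋃ ξ, dec ⁻¹' {(s, ξ)}) = if s' = s then 1 else 0 := by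
    intro s'
    rw [obsGiven, Measure.sum_apply _ hB]
    simp only [Measure.smul_apply, smul_eq_mul, key, ENNReal.tsum_mul_right, PMF.tsum_coe, one_mul]
  rw [obsLaw_apply _ _ hB]
  simp [key']

theorem lintegral_sampleLaw (M : EXBMDP S Ξ A X) (Υ : Finset (List A))
    {φ : List A × X → ℝ≥0∞} (hφ : Measurable φ) :
    ∫⁻ y, φ y ∂M.sampleLaw Υ
      = ∑ υ ∈ Υ, (Υ.card : ℝ≥0∞)⁻¹ * ∫⁻ x, φ (υ, x) ∂M.obsLaw υ := by
  rw [sampleLaw, lintegral_finsetSum_measure]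
  refine Finset.sum_congr rfl fun υ _ => ?_
  rw [lintegral_smul_measure, lintegral_map hφ measurable_prodMk_left, smul_eq_mul]

theorem integral_sampleLaw_snd (M : EXBMDP S Ξ A X) (Υ : Finset (List A)) (g : X → ℝ) (hg : Measurable g) :
    ∫ y, g y.2 ∂M.sampleLaw Υ = ∫ x, g x ∂(M.sampleLaw Υ).snd := by
  rw [Measure.snd, integral_map measurable_snd.aemeasurable hg.aestronglyMeasurable]

variable [Fintype S]

theorem sampleLaw_univ (M : EXBMDP S Ξ A X) {Υ : Finset (List A)} (hΥ : Υ.Nonempty) :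
    M.sampleLaw Υ univ = 1 := by
  have h := M.lintegral_sampleLaw Υ (φ := fun _ => 1) measurable_const
  simp only [lintegral_const, measure_univ, one_mul, mul_one, Finset.sum_const, nsmul_eq_mul] at h
  rw [h, ENNReal.mul_inv_cancel (by simpa using hΥ.ne_empty) (ENNReal.natCast_ne_top _)]

instance (M : EXBMDP S Ξ A X) (Υ : Finset (List A)) : IsFiniteMeasure (M.sampleLaw Υ) := by
  rcases Υ.eq_empty_or_nonempty with rfl | h
  · simp only [sampleLaw, Finset.sum_empty]
    infer_instance
  · exact ⟨by rw [M.sampleLaw_univ h]; exact ENNReal.one_lt_top⟩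

theorem isProbabilityMeasure_sampleLaw (M : EXBMDP S Ξ A X) {Υ : Finset (List A)}
    (hΥ : Υ.Nonempty) : IsProbabilityMeasure (M.sampleLaw Υ) := ⟨M.sampleLaw_univ hΥ⟩

theorem sampleLaw_singleton_prod (M : EXBMDP S Ξ A X) {Υ : Finset (List A)} {υ : List A}
    (hυ : υ ∈ Υ) {B : Set X} (hB : MeasurableSet B) :
    M.sampleLaw Υ ({υ} ×ˢ B) = (Υ.card : ℝ≥0∞)⁻¹ * M.obsLaw υ B := by
  classical
  have hm : MeasurableSet (({υ} : Set (List A)) ×ˢ B) := MeasurableSet.prod trivial hB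
  rw [← lintegral_indicator_one hm,
    lintegral_sampleLaw _ _ (measurable_one.indicator hm), Finset.sum_eq_single υ]
  · rw [← lintegral_indicator_one hB]
    congr 2
    ext x
    simp [indicator]
  · intro υ' _ hne
    have : ∀ x, (({υ} : Set (List A)) ×ˢ B).indicator (1 : List A × X → ℝ≥0∞) (υ', x) = 0 :=
      fun x => indicator_of_notMem (fun h => hne h.1) _
    simp [this]
  · exact fun h => absurd hυ h

namespace IsInverseDynamics

variable {M : EXBMDP S Ξ A X} {Υ : Finset (List A)} {idx : List A → ℕ} {f : X → PMF ℕ}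

/-- Bayes' rule: this turns gaps of classifier outputs into differences of observation laws. -/
theorem withDensity_eq (hf : M.IsInverseDynamics Υ idx f) {υ : List A} (hυ : υ ∈ Υ) :
    (M.sampleLaw Υ).snd.withDensity (fun x => f x (idx υ)) = (Υ.card : ℝ≥0∞)⁻¹ • M.obsLaw υ := by
  ext B hB
  rw [withDensity_apply _ hB, hf υ hυ B hB, M.sampleLaw_singleton_prod hυ hB]
  rfl

/-- A sample may be drawn in the reverse order: the observation from its marginal, then the path
from the conditional probabilities `f`. -/
theorem lintegral_eq (hf : M.IsInverseDynamics Υ idx f) (hfm : ∀ i, Measurable fun x => f x i)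
    {φ : List A × X → ℝ≥0∞} (hφ : Measurable φ) :
    ∫⁻ y, φ y ∂M.sampleLaw Υ
      = ∫⁻ x, ∑ υ ∈ Υ, f x (idx υ) * φ (υ, x) ∂(M.sampleLaw Υ).snd := by
  have hφ' : ∀ υ, Measurable fun x => φ (υ, x) := fun υ => hφ.comp measurable_prodMk_left
  rw [lintegral_finsetSum _ fun υ _ => by fun_prop, lintegral_sampleLaw _ _ hφ]
  refine Finset.sum_congr rfl fun υ hυ => ?_
  rw [← smul_eq_mul, ← lintegral_smul_measure, ← hf.withDensity_eq hυ,
    lintegral_withDensity_eq_lintegral_mul _ (hfm _) (hφ' υ)]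
  rfl

theorem setIntegral_eq (hf : M.IsInverseDynamics Υ idx f)
    (hfm : ∀ i, Measurable fun x => f x i) {υ : List A} (hυ : υ ∈ Υ) {B : Set X}
    (hB : MeasurableSet B) :
    ∫ x in B, (f x (idx υ)).toReal ∂(M.sampleLaw Υ).snd = (M.obsLaw υ).real B / Υ.card := by
  rw [integral_toReal (hfm _).aemeasurable
    (Filter.Eventually.of_forall fun x => (PMF.apply_lt_top _ _)), hf υ hυ B hB,
    M.sampleLaw_singleton_prod hυ hB, ENNReal.toReal_mul, ENNReal.toReal_inv,
    ENNReal.toReal_natCast, Measure.real, inv_mul_eq_div]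

theorem integrable (f : X → PMF ℕ) (hfm : ∀ i, Measurable fun x => f x i) (i : ℕ) (μ : Measure X)
    [IsFiniteMeasure μ] : Integrable (fun x => (f x i).toReal) μ :=
  Integrable.of_bound (hfm i).ennreal_toReal.aestronglyMeasurable 1
    (Filter.Eventually.of_forall fun x => by
      rw [Real.norm_of_nonneg ENNReal.toReal_nonneg]
      exact EndoMDP.toReal_le_one _ _)

theorem integral_eq_integral (hf : M.IsInverseDynamics Υ idx f)
    (hfm : ∀ i, Measurable fun x => f x i) {υ₁ υ₂ : List A} (h₁ : υ₁ ∈ Υ) (h₂ : υ₂ ∈ Υ) :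
    ∫ x, (f x (idx υ₁)).toReal ∂(M.sampleLaw Υ).snd
      = ∫ x, (f x (idx υ₂)).toReal ∂(M.sampleLaw Υ).snd := by
  rw [← setIntegral_univ, hf.setIntegral_eq hfm h₁ MeasurableSet.univ, ← setIntegral_univ,
    hf.setIntegral_eq hfm h₂ MeasurableSet.univ]
  simp

/-- Two paths that most likely lead to the same state have a small gap. -/
theorem integral_gap_le (hf : M.IsInverseDynamics Υ idx f)
    (hfm : ∀ i, Measurable fun x => f x i) {υ₁ υ₂ : List A} (h₁ : υ₁ ∈ Υ) (h₂ : υ₂ ∈ Υ)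
    (hlen : υ₁.length = υ₂.length) {s : S} {ε : ℝ}
    (hs₁ : 1 - ε ≤ (M.endo.pathLaw υ₁ s).toReal) (hs₂ : 1 - ε ≤ (M.endo.pathLaw υ₂ s).toReal) :
    ∫ y, |(f y.2 (idx υ₁)).toReal - (f y.2 (idx υ₂)).toReal| ∂M.sampleLaw Υ
      ≤ 2 * ε / Υ.card := by
  classical
  rw [integral_sampleLaw_snd _ _ (fun x => |(f x (idx υ₁)).toReal - (f x (idx υ₂)).toReal|)
    (((hfm _).ennreal_toReal.sub (hfm _).ennreal_toReal).abs)]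
  obtain ⟨B, hB, h⟩ := exists_integral_abs_sub_le (hfm (idx υ₁)).ennreal_toReal
    (hfm (idx υ₂)).ennreal_toReal
    (integrable f hfm (idx υ₁) (M.sampleLaw Υ).snd) (integrable f hfm (idx υ₂) _)
    (hf.integral_eq_integral hfm h₁ h₂)
  refine h.trans ?_
  rw [hf.setIntegral_eq hfm h₁ hB, hf.setIntegral_eq hfm h₂ hB, ← sub_div, mul_div_assoc]
  -- With `p₁, p₂` the masses at `s` and `b` the probability of `B` given `s`, the difference is at
  -- most `(1 - p₁) * (1 - b) + (1 - p₂) * b`, a convex combination of two numbers that are at most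
  -- `ε`; this gives `ε` and not `2 * ε`.
  have key : (M.obsLaw υ₁).real B - (M.obsLaw υ₂).real B ≤ ε := by
    rw [obsLaw_real_apply _ _ hB, obsLaw_real_apply _ _ hB, ← hlen,
      ← Finset.add_sum_erase _ _ (Finset.mem_univ s), ← Finset.add_sum_erase _ _ (Finset.mem_univ s)]
    have e1 := EndoMDP.sum_toReal_eq_one (M.endo.pathLaw υ₁)
    rw [← Finset.add_sum_erase _ _ (Finset.mem_univ s)] at e1
    have e2 : ∑ x ∈ Finset.univ.erase s, (M.endo.pathLaw υ₁ x).toReal *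
        (M.obsGiven υ₁.length x).real B
        ≤ ∑ x ∈ Finset.univ.erase s, (M.endo.pathLaw υ₁ x).toReal :=
      Finset.sum_le_sum fun x _ => mul_le_of_le_one_right ENNReal.toReal_nonneg measureReal_le_one
    have e3 : 0 ≤ ∑ x ∈ Finset.univ.erase s, (M.endo.pathLaw υ₂ x).toReal *
        (M.obsGiven υ₁.length x).real B := by positivity
    have e4 : 0 ≤ (M.obsGiven υ₁.length s).real B := measureReal_nonneg
    have e5 : (M.obsGiven υ₁.length s).real B ≤ 1 := measureReal_le_one
    have e6 := EndoMDP.toReal_le_one (M.endo.pathLaw υ₁) s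
    nlinarith
  gcongr

/-- Two paths that most likely lead to different states have a large gap. -/
theorem le_integral_gap [Countable Ξ] (hf : M.IsInverseDynamics Υ idx f)
    (hfm : ∀ i, Measurable fun x => f x i) {υ₁ υ₂ : List A} (h₁ : υ₁ ∈ Υ) (h₂ : υ₂ ∈ Υ)
    {s₁ s₂ : S} (hne : s₁ ≠ s₂) {ε : ℝ}
    (hs₁ : 1 - ε ≤ (M.endo.pathLaw υ₁ s₁).toReal)
    (hs₂ : 1 - ε ≤ (M.endo.pathLaw υ₂ s₂).toReal) :
    2 * (1 - 2 * ε) / Υ.card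
      ≤ ∫ y, |(f y.2 (idx υ₁)).toReal - (f y.2 (idx υ₂)).toReal| ∂M.sampleLaw Υ := by
  classical
  rw [integral_sampleLaw_snd _ _ (fun x => |(f x (idx υ₁)).toReal - (f x (idx υ₂)).toReal|)
    (((hfm _).ennreal_toReal.sub (hfm _).ennreal_toReal).abs)]
  obtain ⟨B, hB, h⟩ := M.exists_obsLaw_eq_pathLaw s₁
  refine le_trans ?_ (integral_abs_sub_ge
    (integrable f hfm (idx υ₁) (M.sampleLaw Υ).snd) (integrable f hfm (idx υ₂) _) hB
    (hf.integral_eq_integral hfm h₁ h₂))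
  rw [hf.setIntegral_eq hfm h₁ hB, hf.setIntegral_eq hfm h₂ hB, ← sub_div, mul_div_assoc]
  -- The test set `B` is the event that the decoded endogenous state is `s₁`.
  have key : 1 - 2 * ε ≤ (M.obsLaw υ₁).real B - (M.obsLaw υ₂).real B := by
    rw [Measure.real, Measure.real, h, h]
    have e1 := EndoMDP.sum_toReal_eq_one (M.endo.pathLaw υ₂)
    rw [← Finset.add_sum_erase _ _ (Finset.mem_univ s₂)] at e1
    have e2 := Finset.single_le_sum (f := fun x => (M.endo.pathLaw υ₂ x).toReal)
      (fun _ _ => ENNReal.toReal_nonneg) (Finset.mem_erase.2 ⟨hne, Finset.mem_univ s₁⟩)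
    linarith
  gcongr

end IsInverseDynamics

end EXBMDP

/-! ### Concentration for i.i.d. samples -/

/-- A variable with values in `[0, 1]` is sub-Gaussian with variance proxy `1 / 4`, and the proxies
of independent variables add. -/
theorem exp_sum_ge_le {Ω : Type*} [MeasurableSpace Ω] (μ : Measure Ω) [IsProbabilityMeasure μ]
    {g : Ω → ℝ} (hg : Measurable g) (hg01 : ∀ x, g x ∈ Icc (0 : ℝ) 1) (N : ℕ) {t : ℝ}
    (ht : 0 ≤ t) :
    (Measure.pi fun _ : Fin N => μ).real {D | N * (∫ x, g x ∂μ) + N * t ≤ ∑ n, g (D n)}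
      ≤ Real.exp (-(2 * N * t ^ 2)) := by
  have hind := ProbabilityTheory.iIndepFun_pi (ι := Fin N) (μ := fun _ => μ)
    (X := fun _ x => g x - ∫ x, g x ∂μ) fun _ => (hg.sub_const _).aemeasurable
  have hsub : ∀ n : Fin N, ProbabilityTheory.HasSubgaussianMGF
      (fun D : Fin N → Ω => g (D n) - ∫ x, g x ∂μ) (1 / 4) (Measure.pi fun _ : Fin N => μ) := by
    intro n
    have h := ProbabilityTheory.hasSubgaussianMGF_of_mem_Icc (μ := Measure.pi fun _ : Fin N => μ)
      (X := fun D => g (D n)) (a := 0) (b := 1) (hg.comp (measurable_pi_apply n)).aemeasurable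
      (Filter.Eventually.of_forall fun D => hg01 _)
    rw [integral_comp_eval (μ := fun _ : Fin N => μ) (i := n) (f := g)
      hg.aestronglyMeasurable] at h
    convert h using 1
    norm_num
  have h := ProbabilityTheory.HasSubgaussianMGF.measure_sum_ge_le_of_iIndepFun hind
    (s := Finset.univ) (fun n _ => hsub n) (ε := N * t) (by positivity)
  refine le_trans (le_of_eq ?_) (h.trans (le_of_eq ?_))
  · congr 1
    ext D
    simp only [mem_ofPred_eq, Finset.sum_sub_distrib, Finset.sum_const, Finset.card_univ,
      Fintype.card_fin, nsmul_eq_mul]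
    constructor <;> intro h <;> linarith
  · congr 1
    -- For `N = 0` the sub-Gaussian exponent is a division by zero, with value `0` as required.
    rcases Nat.eq_zero_or_pos N with rfl | hN
    · simp
    · have : (N : ℝ) ≠ 0 := by positivity
      simp only [Finset.sum_const, Finset.card_univ, Fintype.card_fin, nsmul_eq_mul]
      push_cast
      field_simp
      ring

theorem exp_sum_le_le {Ω : Type*} [MeasurableSpace Ω] (μ : Measure Ω) [IsProbabilityMeasure μ]
    {g : Ω → ℝ} (hg : Measurable g) (hg01 : ∀ x, g x ∈ Icc (0 : ℝ) 1) (N : ℕ) {t : ℝ}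
    (ht : 0 ≤ t) :
    (Measure.pi fun _ : Fin N => μ).real {D | ∑ n, g (D n) ≤ N * (∫ x, g x ∂μ) - N * t}
      ≤ Real.exp (-(2 * N * t ^ 2)) := by
  refine le_trans (le_of_eq ?_) (exp_sum_ge_le μ (g := fun x => 1 - g x) (hg.const_sub 1)
    (fun x => ⟨by linarith [(hg01 x).2], by linarith [(hg01 x).1]⟩) N ht)
  have hint : Integrable g μ := Integrable.of_bound hg.aestronglyMeasurable 1
    (Filter.Eventually.of_forall fun x => by
      rw [Real.norm_of_nonneg (hg01 x).1]; exact (hg01 x).2)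
  congr 1
  ext D
  rw [integral_sub (integrable_const 1) hint]
  simp only [mem_ofPred_eq, Finset.sum_sub_distrib, Finset.sum_const, Finset.card_univ,
    Fintype.card_fin, nsmul_eq_mul, integral_const, probReal_univ, smul_eq_mul, mul_one]
  constructor <;> intro h <;> linarith

/-- **Hoeffding's inequality** for the empirical mean. -/
theorem measure_abs_mean_sub_ge_le {Ω : Type*} [MeasurableSpace Ω] (μ : Measure Ω)
    [IsProbabilityMeasure μ] {g : Ω → ℝ} (hg : Measurable g) (hg01 : ∀ x, g x ∈ Icc (0 : ℝ) 1)
    {N : ℕ} (hN : 0 < N) {t : ℝ} (ht : 0 ≤ t) :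
    (Measure.pi fun _ : Fin N => μ) {D | t ≤ |1 / N * ∑ n, g (D n) - ∫ x, g x ∂μ|}
      ≤ ENNReal.ofReal (2 * Real.exp (-(2 * N * t ^ 2))) := by
  have hN' : (0 : ℝ) < N := by exact_mod_cast hN
  refine (measure_mono (t := {D | N * (∫ x, g x ∂μ) + N * t ≤ ∑ n, g (D n)} ∪
    {D | ∑ n, g (D n) ≤ N * (∫ x, g x ∂μ) - N * t}) ?_).trans ((measure_union_le _ _).trans ?_)
  · intro D hD
    have hmean : ∑ n, g (D n) = N * (1 / N * ∑ n, g (D n)) := by field_simp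
    rcases le_abs'.1 (show t ≤ |_| from hD) with h | h
    · right
      change ∑ n, g (D n) ≤ _
      rw [hmean]
      nlinarith
    · left
      change _ ≤ ∑ n, g (D n)
      rw [hmean]
      nlinarith
  · rw [two_mul, ENNReal.ofReal_add (Real.exp_nonneg _) (Real.exp_nonneg _)]
    refine add_le_add ?_ ?_
    · rw [← ofReal_measureReal]
      exact ENNReal.ofReal_le_ofReal (exp_sum_ge_le μ hg hg01 N ht)
    · rw [← ofReal_measureReal]
      exact ENNReal.ofReal_le_ofReal (exp_sum_le_le μ hg hg01 N ht)

theorem lintegral_pi_prod_eq_pow {Ω : Type*} [MeasurableSpace Ω] (μ : Measure Ω)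
    [IsProbabilityMeasure μ] {φ : Ω → ℝ≥0∞} (hφ : Measurable φ) (N : ℕ) :
    ∫⁻ D, ∏ n, φ (D n) ∂(Measure.pi fun _ : Fin N => μ) = (∫⁻ x, φ x ∂μ) ^ N := by
  have hind : ProbabilityTheory.iIndepFun (fun (n : Fin N) (D : Fin N → Ω) => φ (D n))
      (Measure.pi fun _ : Fin N => μ) :=
    ProbabilityTheory.iIndepFun_pi (X := fun _ => φ) fun _ => hφ.aemeasurable
  have hev : ∀ n : Fin N, ∫⁻ D, φ (D n) ∂(Measure.pi fun _ : Fin N => μ) = ∫⁻ x, φ x ∂μ :=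
    fun n => (measurePreserving_eval (fun _ : Fin N => μ) n).lintegral_comp hφ
  rw [ProbabilityTheory.lintegral_prod_eq_prod_lintegral_of_indepFun Finset.univ _ hind
    fun n => hφ.comp (measurable_pi_apply n)]
  simp [hev]

/-! ### In-sample guarantee for maximum likelihood -/

namespace PPE

variable {A X : Type*}

/-- The Bhattacharyya affinity of the predictions of two classifiers on the labels of `Υ`. -/
def affinity (Υ : Finset (List A)) (idx : List A → ℕ) (f g : X → PMF ℕ) (x : X) : ℝ :=
  ∑ υ ∈ Υ, √((f x (idx υ)).toReal * (g x (idx υ)).toReal)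

section

variable {Υ : Finset (List A)} {idx : List A → ℕ}

theorem sum_toReal_le_one (hidx : Set.InjOn idx (Υ : Set (List A))) (p : PMF ℕ) :
    ∑ υ ∈ Υ, (p (idx υ)).toReal ≤ 1 := by
  classical
  rw [← ENNReal.toReal_sum fun υ _ => p.apply_ne_top _]
  refine ENNReal.toReal_le_of_le_ofReal zero_le_one ?_
  rw [ENNReal.ofReal_one, ← p.tsum_coe, ← Finset.sum_image (f := p) (g := idx) hidx]
  exact ENNReal.sum_le_tsum _

theorem affinity_mul_exp_le_one (f g : X → PMF ℕ) (x : X) :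
    affinity Υ idx f g x * Real.exp (1 - affinity Υ idx f g x) ≤ 1 := by
  have h := Real.add_one_le_exp (affinity Υ idx f g x - 1)
  calc affinity Υ idx f g x * Real.exp (1 - affinity Υ idx f g x)
      ≤ Real.exp (affinity Υ idx f g x - 1) * Real.exp (1 - affinity Υ idx f g x) := by
        gcongr
        linarith
    _ = 1 := by rw [← Real.exp_add]; simp

/-- Cauchy–Schwarz for `|a - b| = |√a - √b| * (√a + √b)`: the squares of the two factors sum to at
most `2 - 2 * affinity` and `4`. Only total mass at most one on the labels of `Υ` is needed, so
classifiers may put mass on other labels. -/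
theorem sq_sum_abs_sub_le (hidx : Set.InjOn idx (Υ : Set (List A))) (f g : X → PMF ℕ) (x : X) :
    (∑ υ ∈ Υ, |(f x (idx υ)).toReal - (g x (idx υ)).toReal|) ^ 2
      ≤ 8 * (1 - affinity Υ idx f g x) := by
  set a : List A → ℝ := fun υ => (f x (idx υ)).toReal with ha
  set b : List A → ℝ := fun υ => (g x (idx υ)).toReal with hb
  have ha0 : ∀ υ, 0 ≤ a υ := fun _ => ENNReal.toReal_nonneg
  have hb0 : ∀ υ, 0 ≤ b υ := fun _ => ENNReal.toReal_nonneg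
  have ha1 : ∑ υ ∈ Υ, a υ ≤ 1 := sum_toReal_le_one hidx (f x)
  have hb1 : ∑ υ ∈ Υ, b υ ≤ 1 := sum_toReal_le_one hidx (g x)
  have haff : affinity Υ idx f g x = ∑ υ ∈ Υ, √(a υ) * √(b υ) :=
    Finset.sum_congr rfl fun υ _ => Real.sqrt_mul (ha0 υ) _
  have h1 : ∀ υ, |a υ - b υ| = |√(a υ) - √(b υ)| * (√(a υ) + √(b υ)) := by
    intro υ
    have e : a υ - b υ = (√(a υ) - √(b υ)) * (√(a υ) + √(b υ)) := by
      nlinarith [Real.sq_sqrt (ha0 υ), Real.sq_sqrt (hb0 υ)]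
    rw [e, abs_mul, abs_of_nonneg (by positivity : 0 ≤ √(a υ) + √(b υ))]
  have h2 := Finset.sum_mul_sq_le_sq_mul_sq Υ (fun υ => |√(a υ) - √(b υ)|)
    (fun υ => √(a υ) + √(b υ))
  have h3 : ∑ υ ∈ Υ, |√(a υ) - √(b υ)| ^ 2
      = ∑ υ ∈ Υ, a υ + ∑ υ ∈ Υ, b υ - 2 * affinity Υ idx f g x := by
    rw [haff, Finset.mul_sum, ← Finset.sum_add_distrib, ← Finset.sum_sub_distrib]
    refine Finset.sum_congr rfl fun υ _ => ?_
    rw [sq_abs]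
    nlinarith [Real.sq_sqrt (ha0 υ), Real.sq_sqrt (hb0 υ)]
  have h4 : ∑ υ ∈ Υ, (√(a υ) + √(b υ)) ^ 2 ≤ 2 * (∑ υ ∈ Υ, a υ + ∑ υ ∈ Υ, b υ) := by
    rw [← Finset.sum_add_distrib, Finset.mul_sum]
    refine Finset.sum_le_sum fun υ _ => ?_
    nlinarith [Real.sq_sqrt (ha0 υ), Real.sq_sqrt (hb0 υ), sq_nonneg (√(a υ) - √(b υ))]
  have h5 : 0 ≤ ∑ υ ∈ Υ, |√(a υ) - √(b υ)| ^ 2 := by positivity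
  have h6 : 0 ≤ ∑ υ ∈ Υ, (√(a υ) + √(b υ)) ^ 2 := by positivity
  change (∑ υ ∈ Υ, |a υ - b υ|) ^ 2 ≤ _
  rw [Finset.sum_congr rfl fun υ _ => h1 υ]
  refine h2.trans ?_
  calc _ ≤ (∑ υ ∈ Υ, |√(a υ) - √(b υ)| ^ 2) * 4 := by
        gcongr
        linarith
    _ ≤ _ := by linarith

/-- Empirical gaps of two classifiers with large empirical affinity are close. -/
theorem sq_gap_sub_gap_le (hidx : Set.InjOn idx (Υ : Set (List A))) (f g : X → PMF ℕ) {N : ℕ}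
    (hN : 0 < N) (D : Fin N → List A × X) {υ₁ υ₂ : List A} (h₁ : υ₁ ∈ Υ) (h₂ : υ₂ ∈ Υ)
    (hne : υ₁ ≠ υ₂) :
    (gap f D (idx υ₁) (idx υ₂) - gap g D (idx υ₁) (idx υ₂)) ^ 2
      ≤ 8 / N * ∑ n, (1 - affinity Υ idx f g (D n).2) := by
  classical
  have hN' : (0 : ℝ) < N := by exact_mod_cast hN
  set u : Fin N → ℝ := fun n =>
    ∑ υ ∈ Υ, |(f (D n).2 (idx υ)).toReal - (g (D n).2 (idx υ)).toReal| with hu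
  have hpt : ∀ n, |(|(f (D n).2 (idx υ₁)).toReal - (f (D n).2 (idx υ₂)).toReal|
      - |(g (D n).2 (idx υ₁)).toReal - (g (D n).2 (idx υ₂)).toReal|)| ≤ u n := by
    intro n
    have e1 : |(f (D n).2 (idx υ₁)).toReal - (g (D n).2 (idx υ₁)).toReal|
        + |(f (D n).2 (idx υ₂)).toReal - (g (D n).2 (idx υ₂)).toReal| ≤ u n := by
      rw [← Finset.sum_pair (f := fun υ =>
        |(f (D n).2 (idx υ)).toReal - (g (D n).2 (idx υ)).toReal|) hne]
      refine Finset.sum_le_sum_of_subset_of_nonneg ?_ fun _ _ _ => abs_nonneg _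
      intro υ hυ
      rcases Finset.mem_insert.1 hυ with rfl | hυ
      · exact h₁
      · rwa [Finset.mem_singleton.1 hυ]
    refine (abs_abs_sub_abs_le_abs_sub _ _).trans (le_trans ?_ e1)
    rw [sub_sub_sub_comm]
    exact abs_sub _ _
  have habs : |gap f D (idx υ₁) (idx υ₂) - gap g D (idx υ₁) (idx υ₂)| ≤ 1 / N * ∑ n, u n := by
    rw [gap, gap, ← mul_sub, ← Finset.sum_sub_distrib, abs_mul,
      abs_of_nonneg (by positivity : (0 : ℝ) ≤ 1 / N)]
    gcongr
    exact (Finset.abs_sum_le_sum_abs _ _).trans (Finset.sum_le_sum fun n _ => hpt n)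
  have hcs : (∑ n, u n) ^ 2 ≤ N * ∑ n, u n ^ 2 := by
    simpa using sq_sum_le_card_mul_sum_sq (s := Finset.univ) (f := u)
  have hsum : ∑ n, u n ^ 2 ≤ 8 * ∑ n, (1 - affinity Υ idx f g (D n).2) := by
    rw [Finset.mul_sum]
    exact Finset.sum_le_sum fun n _ => sq_sum_abs_sub_le hidx f g (D n).2
  rw [← sq_abs]
  calc _ ≤ (1 / N * ∑ n, u n) ^ 2 := by gcongr
    _ = 1 / N ^ 2 * (∑ n, u n) ^ 2 := by ring
    _ ≤ 1 / N ^ 2 * (N * (8 * ∑ n, (1 - affinity Υ idx f g (D n).2))) := by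
        gcongr
        exact hcs.trans (by gcongr)
    _ = _ := by field_simp

end

section

variable [MeasurableSpace X]

instance : DiscreteMeasurableSpace (List A) := ⟨fun _ => trivial⟩

theorem measurable_predict [Countable A] (idx : List A → ℕ) {f : X → PMF ℕ}
    (hfm : ∀ i, Measurable fun x => f x i) :
    Measurable fun y : List A × X => f y.2 (idx y.1) :=
  measurable_from_prod_countable_right fun υ => hfm (idx υ)

theorem measurable_affinity (Υ : Finset (List A)) (idx : List A → ℕ) {f g : X → PMF ℕ}
    (hfm : ∀ i, Measurable fun x => f x i) (hgm : ∀ i, Measurable fun x => g x i) :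
    Measurable (affinity Υ idx f g) :=
  Finset.measurable_sum _ fun υ _ =>
    ((hfm (idx υ)).ennreal_toReal.mul (hgm (idx υ)).ennreal_toReal).sqrt

/-- The square root of the likelihood ratio of one sample, with an exponential weight that makes
its expectation at most one. -/
def ratio (Υ : Finset (List A)) (idx : List A → ℕ) (f g : X → PMF ℕ) (y : List A × X) : ℝ :=
  √((f y.2 (idx y.1)).toReal / (g y.2 (idx y.1)).toReal) *
    Real.exp (1 - affinity Υ idx f g y.2)

theorem measurable_ratio [Countable A] (Υ : Finset (List A)) (idx : List A → ℕ) {f g : X → PMF ℕ}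
    (hfm : ∀ i, Measurable fun x => f x i) (hgm : ∀ i, Measurable fun x => g x i) :
    Measurable (ratio Υ idx f g) :=
  ((measurable_predict idx hfm).ennreal_toReal.div
    (measurable_predict idx hgm).ennreal_toReal).sqrt.mul
    (((measurable_affinity Υ idx hfm hgm).comp measurable_snd).const_sub 1).exp

end

section

variable {S Ξ : Type*} [MeasurableSpace X] [Fintype A] [Fintype S]
  {M : EXBMDP S Ξ A X} {Υ : Finset (List A)} {idx : List A → ℕ} {g : X → PMF ℕ}

/-- Given `x`, the path has law `g x`, so the square root of the ratio averages to at most the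
affinity `ρ` at `x`, and `ρ * exp (1 - ρ) ≤ 1`. Putting the weight inside the expectation makes the
final bound one on the observed sample. -/
theorem lintegral_ratio_le_one (hΥ : Υ.Nonempty) {f : X → PMF ℕ}
    (hfm : ∀ i, Measurable fun x => f x i) (hgm : ∀ i, Measurable fun x => g x i)
    (hg : M.IsInverseDynamics Υ idx g) :
    ∫⁻ y, ENNReal.ofReal (ratio Υ idx f g y) ∂M.sampleLaw Υ ≤ 1 := by
  have := M.isProbabilityMeasure_sampleLaw hΥ
  rw [hg.lintegral_eq hgm (measurable_ratio Υ idx hfm hgm).ennreal_ofReal]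
  calc _ ≤ ∫⁻ _, 1 ∂(M.sampleLaw Υ).snd := lintegral_mono fun x => ?_
    _ = 1 := by simp
  have key : ∀ υ, g x (idx υ) * ENNReal.ofReal (ratio Υ idx f g (υ, x))
      = ENNReal.ofReal (√((f x (idx υ)).toReal * (g x (idx υ)).toReal) *
          Real.exp (1 - affinity Υ idx f g x)) := by
    intro υ
    conv_lhs => rw [← ENNReal.ofReal_toReal (PMF.apply_ne_top (g x) (idx υ))]
    rw [← ENNReal.ofReal_mul ENNReal.toReal_nonneg, ratio, ← mul_assoc]
    congr 2
    set a := (f x (idx υ)).toReal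
    have hb : 0 ≤ (g x (idx υ)).toReal := ENNReal.toReal_nonneg
    set b := (g x (idx υ)).toReal
    change b * √(a / b) = √(a * b)
    rcases hb.eq_or_lt with hb | hb
    · simp [← hb]
    · conv_lhs => rw [← Real.sqrt_sq hb.le]
      rw [← Real.sqrt_mul (sq_nonneg _), Real.sqrt_sq hb.le]
      congr 1
      field_simp
  simp only [key]
  rw [← ENNReal.ofReal_sum_of_nonneg fun _ _ => by positivity, ← Finset.sum_mul,
    ← ENNReal.ofReal_one]
  exact ENNReal.ofReal_le_ofReal (affinity_mul_exp_le_one f g x)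

theorem sampleLaw_predict_eq_zero (hgm : ∀ i, Measurable fun x => g x i)
    (hg : M.IsInverseDynamics Υ idx g) :
    M.sampleLaw Υ {y | g y.2 (idx y.1) = 0} = 0 := by
  have hm : MeasurableSet {y : List A × X | g y.2 (idx y.1) = 0} :=
    measurable_predict idx hgm (measurableSet_singleton 0)
  rw [← lintegral_indicator_one hm, hg.lintegral_eq hgm (measurable_one.indicator hm)]
  have : ∀ x, ∑ υ ∈ Υ, g x (idx υ) *
      {y : List A × X | g y.2 (idx y.1) = 0}.indicator (1 : List A × X → ℝ≥0∞) (υ, x) = 0 := by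
    intro x
    refine Finset.sum_eq_zero fun υ _ => ?_
    by_cases h : g x (idx υ) = 0
    · rw [h, zero_mul]
    · rw [indicator_of_notMem (by exact h), mul_zero]
  simp [this]

/-- On this event the product of the ratios is at least `exp L`, while its mean is at most one by
independence; Markov's inequality concludes. -/
theorem measure_likelihood_le_and_le_sum_le (hΥ : Υ.Nonempty) {f : X → PMF ℕ}
    (hfm : ∀ i, Measurable fun x => f x i) (hgm : ∀ i, Measurable fun x => g x i)
    (hg : M.IsInverseDynamics Υ idx g) (N : ℕ) (L : ℝ) :
    (Measure.pi fun _ : Fin N => M.sampleLaw Υ) {D | likelihood idx g D ≤ likelihood idx f D ∧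
      L ≤ ∑ n, (1 - affinity Υ idx f g (D n).2)} ≤ ENNReal.ofReal (Real.exp (-L)) := by
  have := M.isProbabilityMeasure_sampleLaw hΥ
  have hrm := (measurable_ratio Υ idx hfm hgm).ennreal_ofReal
  have hsub : {D : Fin N → List A × X | likelihood idx g D ≤ likelihood idx f D ∧
      L ≤ ∑ n, (1 - affinity Υ idx f g (D n).2)} ⊆
      (⋃ n, Function.eval n ⁻¹' {y | g y.2 (idx y.1) = 0}) ∪
      {D | ENNReal.ofReal (Real.exp L) ≤ ∏ n, ENNReal.ofReal (ratio Υ idx f g (D n))} := by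
    rintro D ⟨hD, hL⟩
    -- A vanishing prediction of `g` would make the ratio the default value `0`; this happens on a
    -- null set only.
    by_cases hz : ∃ n, g (D n).2 (idx (D n).1) = 0
    · exact Or.inl (mem_iUnion.2 hz)
    push Not at hz
    right
    have hpos : ∀ n, 0 < (g (D n).2 (idx (D n).1)).toReal := fun n =>
      ENNReal.toReal_pos (hz n) (PMF.apply_ne_top _ _)
    have hD' : ∏ n, (g (D n).2 (idx (D n).1)).toReal ≤ ∏ n, (f (D n).2 (idx (D n).1)).toReal := by
      rw [← ENNReal.toReal_prod, ← ENNReal.toReal_prod]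
      exact ENNReal.toReal_mono (ENNReal.prod_ne_top fun n _ => PMF.apply_ne_top _ _) hD
    have hprod : 0 < ∏ n, (g (D n).2 (idx (D n).1)).toReal := Finset.prod_pos fun n _ => hpos n
    change _ ≤ ∏ n, ENNReal.ofReal (ratio Υ idx f g (D n))
    rw [← ENNReal.ofReal_prod_of_nonneg fun n _ => by unfold ratio; positivity]
    refine ENNReal.ofReal_le_ofReal ?_
    simp only [ratio, Finset.prod_mul_distrib, ← Real.exp_sum]
    have h1 : 1 ≤ ∏ n, √((f (D n).2 (idx (D n).1)).toReal / (g (D n).2 (idx (D n).1)).toReal) := by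
      rw [← Real.sqrt_prod _ fun n _ => by positivity, Finset.prod_div_distrib]
      exact Real.one_le_sqrt.2 ((one_le_div hprod).2 hD')
    calc Real.exp L ≤ 1 * Real.exp (∑ n, (1 - affinity Υ idx f g (D n).2)) := by
          rw [one_mul]; exact Real.exp_le_exp.2 hL
      _ ≤ _ := by gcongr
  refine (measure_mono hsub).trans ((measure_union_le _ _).trans ?_)
  rw [measure_iUnion_null fun n => Measure.pi_eval_preimage_null (fun _ : Fin N => M.sampleLaw Υ)
    (i := n) (sampleLaw_predict_eq_zero hgm hg), zero_add]
  have hint : ∫⁻ D, ∏ n, ENNReal.ofReal (ratio Υ idx f g (D n))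
      ∂(Measure.pi fun _ : Fin N => M.sampleLaw Υ) ≤ 1 := by
    rw [lintegral_pi_prod_eq_pow _ hrm]
    exact pow_le_one₀ zero_le (lintegral_ratio_le_one hΥ hfm hgm hg)
  have hmk := mul_meas_ge_le_lintegral₀ (μ := Measure.pi fun _ : Fin N => M.sampleLaw Υ)
    (f := fun D => ∏ n, ENNReal.ofReal (ratio Υ idx f g (D n)))
    (Finset.measurable_prod _ fun n _ => hrm.comp (measurable_pi_apply n)).aemeasurable
    (ENNReal.ofReal (Real.exp L))
  rw [Real.exp_neg, ENNReal.ofReal_inv_of_pos (Real.exp_pos _), ← one_div,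
    ENNReal.le_div_iff_mul_le (Or.inl (by simp [Real.exp_pos])) (Or.inl ENNReal.ofReal_ne_top),
    mul_comm]
  exact hmk.trans hint

/-- With high probability, the empirical gaps of every classifier that is at least as likely as the
inverse dynamics are close to the expected gaps of the inverse dynamics. -/
theorem measure_exists_lt_abs_gap_sub_le (hΥ : Υ.Nonempty)
    (hidx : Set.InjOn idx (Υ : Set (List A))) {F : Finset (X → PMF ℕ)}
    (hF : ∀ f ∈ F, ∀ i, Measurable fun x => f x i) (hgF : g ∈ F)
    (hg : M.IsInverseDynamics Υ idx g) {N : ℕ} (hN : 0 < N) {ε : ℝ} (hε : 0 < ε) :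
    (Measure.pi fun _ : Fin N => M.sampleLaw Υ) {D | ∃ f ∈ F,
      likelihood idx g D ≤ likelihood idx f D ∧ ∃ υ₁ ∈ Υ, ∃ υ₂ ∈ Υ, υ₁ ≠ υ₂ ∧
        2 * ε < |gap f D (idx υ₁) (idx υ₂) -
          ∫ y, |(g y.2 (idx υ₁)).toReal - (g y.2 (idx υ₂)).toReal| ∂M.sampleLaw Υ|}
      ≤ ENNReal.ofReal (F.card * Real.exp (-(N * ε ^ 2 / 8)) +
          Υ.card ^ 2 * (2 * Real.exp (-(2 * N * ε ^ 2)))) := by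
  have := M.isProbabilityMeasure_sampleLaw hΥ
  have hN' : (0 : ℝ) < N := by exact_mod_cast hN
  have hgm := hF g hgF
  refine (measure_mono (t := (⋃ f ∈ F, {D | likelihood idx g D ≤ likelihood idx f D ∧
      N * ε ^ 2 / 8 ≤ ∑ n, (1 - affinity Υ idx f g (D n).2)}) ∪
      ⋃ q ∈ Υ ×ˢ Υ, {D | ε ≤ |gap g D (idx q.1) (idx q.2) -
          ∫ y, |(g y.2 (idx q.1)).toReal - (g y.2 (idx q.2)).toReal| ∂M.sampleLaw Υ|}) ?_).trans
    ((measure_union_le _ _).trans ?_)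
  · rintro D ⟨f, hf, hl, υ₁, h₁, υ₂, h₂, hne, hgap⟩
    -- At this level `sq_gap_sub_gap_le` bounds the squared difference of the gaps by `ε ^ 2`; the
    -- second `ε` in `2 * ε` is the Hoeffding error.
    by_cases hL : N * ε ^ 2 / 8 ≤ ∑ n, (1 - affinity Υ idx f g (D n).2)
    · exact Or.inl (mem_iUnion₂.2 ⟨f, hf, hl, hL⟩)
    · refine Or.inr (mem_iUnion₂.2 ⟨(υ₁, υ₂), Finset.mk_mem_product h₁ h₂, ?_⟩)
      have hsq := sq_gap_sub_gap_le hidx f g hN D h₁ h₂ hne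
      have hlt : (gap f D (idx υ₁) (idx υ₂) - gap g D (idx υ₁) (idx υ₂)) ^ 2 < ε ^ 2 := by
        refine hsq.trans_lt ?_
        calc 8 / N * ∑ n, (1 - affinity Υ idx f g (D n).2) < 8 / N * (N * ε ^ 2 / 8) := by
              have := not_le.1 hL
              gcongr
          _ = ε ^ 2 := by field_simp
      have habs := abs_lt_of_sq_lt_sq hlt hε.le
      have htri := abs_sub_le (gap f D (idx υ₁) (idx υ₂)) (gap g D (idx υ₁) (idx υ₂))
        (∫ y, |(g y.2 (idx υ₁)).toReal - (g y.2 (idx υ₂)).toReal| ∂M.sampleLaw Υ)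
      change ε ≤ |_|
      linarith
  · rw [ENNReal.ofReal_add (by positivity) (by positivity)]
    refine add_le_add ?_ ?_
    · refine (measure_biUnion_finset_le _ _).trans ((Finset.sum_le_sum fun f hf =>
        measure_likelihood_le_and_le_sum_le hΥ (hF f hf) hgm hg N _).trans ?_)
      rw [Finset.sum_const, nsmul_eq_mul, ENNReal.ofReal_mul (by positivity),
        ENNReal.ofReal_natCast]
    · refine (measure_biUnion_finset_le _ _).trans ((Finset.sum_le_sum fun q hq =>
        measure_abs_mean_sub_ge_le (M.sampleLaw Υ)
          (g := fun y => |(g y.2 (idx q.1)).toReal - (g y.2 (idx q.2)).toReal|)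
          ?_ ?_ hN hε.le).trans ?_)
      · exact (((hgm _).comp measurable_snd).ennreal_toReal.sub
          ((hgm _).comp measurable_snd).ennreal_toReal).abs
      · intro y
        have e1 := EndoMDP.toReal_le_one (g y.2) (idx q.1)
        have e2 := EndoMDP.toReal_le_one (g y.2) (idx q.2)
        have e3 : 0 ≤ (g y.2 (idx q.1)).toReal := ENNReal.toReal_nonneg
        have e4 : 0 ≤ (g y.2 (idx q.2)).toReal := ENNReal.toReal_nonneg
        exact ⟨abs_nonneg _, abs_le.2 ⟨by linarith, by linarith⟩⟩
      · rw [Finset.sum_const, nsmul_eq_mul, Finset.card_product, ← ENNReal.ofReal_natCast,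
          ← ENNReal.ofReal_mul (by positivity), Nat.cast_mul, ← sq]

end

end PPE

/-! ### Minimal covers, elimination, and the iteration of PPE -/

namespace EndoMDP

variable {S A : Type*} {D : EndoMDP S A} {h : ℕ} {Ψ : Finset (List A)}

theorem isMinimalPolicyCover_zero (hD : D.IsDeterministic) :
    D.IsMinimalPolicyCover 0 {[]} := by
  refine ⟨by simp, fun s hs => ?_⟩
  obtain ⟨υ, hυ, hυs⟩ := hD.mem_reachable_iff.1 hs
  obtain rfl := List.length_eq_zero_iff.1 hυ
  exact ⟨[], ⟨by simp, (hD.pathLaw_eq_one_iff _ _).2 hυs⟩, fun υ' h' => by simpa using h'.1⟩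

namespace IsMinimalPolicyCover

theorem nonempty [Nonempty A] (hD : D.IsDeterministic) (hΨ : D.IsMinimalPolicyCover h Ψ) :
    Ψ.Nonempty := by
  obtain ⟨a⟩ := ‹Nonempty A›
  obtain ⟨s, hs⟩ := hD.exists_pathLaw_eq_pure (List.replicate h a)
  obtain ⟨υ, ⟨hυ, -⟩, -⟩ := hΨ.2 s (hD.mem_reachable_iff.2 ⟨_, by simp, hs⟩)
  exact ⟨υ, hυ⟩

/-- Distinct paths of the cover end in distinct states. This bound makes realizability applicable in
the next iteration. -/
theorem card_le [Fintype S] (hD : D.IsDeterministic) (hΨ : D.IsMinimalPolicyCover h Ψ) :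
    Ψ.card ≤ Fintype.card S := by
  choose e he using hD.exists_pathLaw_eq_pure
  refine Finset.card_le_card_of_injOn e (fun _ _ => Finset.mem_coe.2 (Finset.mem_univ _)) ?_
  intro υ₁ h₁ υ₂ h₂ heq
  have hr : e υ₁ ∈ D.reachable h := hD.mem_reachable_iff.2 ⟨υ₁, hΨ.1 _ h₁, he _⟩
  exact (hΨ.2 _ hr).unique ⟨h₁, (hD.pathLaw_eq_one_iff _ _).2 (he _)⟩
    ⟨h₂, (hD.pathLaw_eq_one_iff _ _).2 (by rw [heq]; exact he _)⟩

end IsMinimalPolicyCover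

end EndoMDP

namespace PPE

variable {S Ξ A X : Type*}

section

variable [MeasurableSpace X]

theorem measurable_gap {f : X → PMF ℕ} (hfm : ∀ i, Measurable fun x => f x i) {N : ℕ} (i j : ℕ) :
    Measurable fun D : Fin N → List A × X => gap f D i j := by
  have h : ∀ i, ∀ n : Fin N, Measurable fun D : Fin N → List A × X => (f (D n).2 i).toReal :=
    fun i n => ((hfm i).comp (measurable_snd.comp (measurable_pi_apply n))).ennreal_toReal
  exact (Finset.measurable_sum _ fun n _ => ((h i n).sub (h j n)).abs).const_mul _

/-- The fitted classifier takes finitely many values, so the data space splits into measurable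
pieces on which it is fixed. -/
theorem measurable_eliminate [Countable A] {F : Finset (X → PMF ℕ)}
    (hF : ∀ f ∈ F, ∀ i, Measurable fun x => f x i) {N : ℕ}
    {idx : Finset (List A) → List A → ℕ}
    {mle : Finset (List A) → (Fin N → List A × X) → X → PMF ℕ} (hmle : IsMLE F idx mle)
    (Υ : Finset (List A)) : Measurable fun D => eliminate (idx Υ) (mle Υ D) Υ D := by
  have hfix : ∀ f ∈ F, Measurable fun D : Fin N → List A × X => eliminate (idx Υ) f Υ D := by
    intro f hf
    refine measurable_finset_iff.2 fun υ => ?_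
    simp only [eliminate, Finset.mem_filter]
    refine Measurable.and measurable_const (Measurable.not ?_)
    refine Measurable.exists fun υ' => ?_
    refine Measurable.and measurable_const (Measurable.and measurable_const ?_)
    exact measurableSet_setOfPred.1
      (measurableSet_le (measurable_gap (hF f hf) _ _) measurable_const)
  intro E hE
  have : (fun D => eliminate (idx Υ) (mle Υ D) Υ D) ⁻¹' E
      = ⋃ f ∈ F, {D | mle Υ D = f} ∩ (fun D => eliminate (idx Υ) f Υ D) ⁻¹' E := by
    ext D
    simp only [mem_iUnion, mem_inter_iff, mem_preimage, exists_prop]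
    constructor
    · exact fun h => ⟨mle Υ D, ((hmle Υ).1 D).1, rfl, h⟩
    · rintro ⟨f, -, hfD, h⟩
      have hfD' : mle Υ D = f := hfD
      rwa [hfD']
  rw [this]
  exact Finset.measurableSet_biUnion _ fun f hf => ((hmle Υ).2 f hf).inter (hfix f hf hE)

end

variable [Fintype A] [DecidableEq A]

theorem mem_extend {Ψ : Finset (List A)} {υ : List A} :
    υ ∈ extend Ψ ↔ ∃ υ₀ ∈ Ψ, ∃ a, υ₀ ++ [a] = υ := by
  simp [extend]

theorem card_extend_le (Ψ : Finset (List A)) : (extend Ψ).card ≤ Ψ.card * Fintype.card A := by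
  refine Finset.card_image_le.trans ?_
  rw [Finset.card_product, Finset.card_univ]

theorem extend_nonempty [Nonempty A] {Ψ : Finset (List A)} (hΨ : Ψ.Nonempty) :
    (extend Ψ).Nonempty := by
  obtain ⟨υ, hυ⟩ := hΨ
  obtain ⟨a⟩ := ‹Nonempty A›
  exact ⟨υ ++ [a], mem_extend.2 ⟨υ, hυ, a, rfl⟩⟩

/-- If the gap test identifies the paths that lead to the same state, then elimination turns the
extension of a minimal policy cover into a minimal policy cover. -/
theorem isMinimalPolicyCover_eliminate {D : EndoMDP S A} (hD : D.IsDeterministic) {h : ℕ}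
    {Ψ : Finset (List A)} (hΨ : D.IsMinimalPolicyCover h Ψ) {idx : List A → ℕ}
    (hidx : Set.InjOn idx (extend Ψ : Set (List A))) {N : ℕ} {f : X → PMF ℕ}
    {data : Fin N → List A × X}
    (hgap : ∀ υ₁ ∈ extend Ψ, ∀ υ₂ ∈ extend Ψ, υ₁ ≠ υ₂ →
      (gap f data (idx υ₁) (idx υ₂) ≤ 5 / (8 * ((extend Ψ).card : ℝ)) ↔
        D.pathLaw υ₁ = D.pathLaw υ₂)) :
    D.IsMinimalPolicyCover (h + 1) (eliminate idx f (extend Ψ) data) := by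
  classical
  have hmem : ∀ υ, υ ∈ eliminate idx f (extend Ψ) data ↔ υ ∈ extend Ψ ∧
      ∀ υ' ∈ extend Ψ, idx υ' < idx υ → D.pathLaw υ' ≠ D.pathLaw υ := by
    intro υ
    simp only [eliminate, Finset.mem_filter, not_exists, not_and]
    refine and_congr_right fun hυ => forall₃_congr fun υ' hυ' hlt => not_congr ?_
    exact hgap υ' hυ' υ hυ fun heq => by simp [heq] at hlt
  refine ⟨fun υ hυ => ?_, fun s hs => ?_⟩
  · obtain ⟨υ₀, h₀, a, rfl⟩ := mem_extend.1 ((hmem υ).1 hυ).1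
    simp [hΨ.1 υ₀ h₀]
  · simp only [hD.pathLaw_eq_one_iff, hmem]
    obtain ⟨υ, hυ, hυs⟩ := hD.mem_reachable_iff.1 hs
    -- A path to `s` need not extend a path of the cover, but its prefix can be replaced by the
    -- covering path with the same end state.
    have hne : ((extend Ψ).filter fun υ => D.pathLaw υ = PMF.pure s).Nonempty := by
      rcases List.eq_nil_or_concat υ with rfl | ⟨υ₀, a, rfl⟩
      · simp at hυ
      · rw [List.concat_eq_append] at hυ hυs
        obtain ⟨s₀, hs₀⟩ := hD.exists_pathLaw_eq_pure υ₀
        obtain ⟨υ₁, ⟨h₁, h₁s⟩, -⟩ := hΨ.2 s₀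
          (hD.mem_reachable_iff.2 ⟨υ₀, by simpa using hυ, hs₀⟩)
        rw [hD.pathLaw_eq_one_iff] at h₁s
        refine ⟨υ₁ ++ [a], Finset.mem_filter.2 ⟨mem_extend.2 ⟨υ₁, h₁, a, rfl⟩, ?_⟩⟩
        rw [EndoMDP.pathLaw_concat, h₁s, ← hs₀, ← EndoMDP.pathLaw_concat, hυs]
    obtain ⟨υ₁, h₁, hmin⟩ := Finset.exists_min_image _ idx hne
    rw [Finset.mem_filter] at h₁
    refine ⟨υ₁, ⟨⟨h₁.1, fun υ' h' hlt heq => ?_⟩, h₁.2⟩, ?_⟩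
    · exact (hmin υ' (Finset.mem_filter.2 ⟨h', heq.trans h₁.2⟩)).not_gt hlt
    · rintro υ₂ ⟨⟨h₂, h₂min⟩, h₂s⟩
      refine hidx h₂ h₁.1 (le_antisymm ?_ (hmin υ₂ (Finset.mem_filter.2 ⟨h₂, h₂s⟩)))
      exact not_lt.1 fun hlt => h₂min υ₁ h₁.1 hlt (h₁.2.trans h₂s.symm)

variable [MeasurableSpace X] [Fintype S]

/-- The history enters both through the update and through the path set to be extended. Treating the
latter as a separate variable in a countable space leaves measurability in the history for a fixed
path set. -/
theorem measurable_kernel (M : EXBMDP S Ξ A X) {N : ℕ} (idx : Finset (List A) → List A → ℕ)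
    (mle : Finset (List A) → (Fin N → List A × X) → X → PMF ℕ) (n : ℕ) :
    Measurable fun Ψ : ℕ → Finset (List A) =>
      (iterationLaw M idx mle (extend (Ψ n))).map (Function.update Ψ (n + 1)) := by
  have hupd : Measurable fun p : (ℕ → Finset (List A)) × Finset (List A) =>
      Function.update p.1 (n + 1) p.2 := by
    refine measurable_pi_lambda _ fun k => ?_
    by_cases hk : k = n + 1
    · subst hk
      simpa using measurable_snd
    · simp only [Function.update_of_ne hk]
      exact (measurable_pi_apply k).comp measurable_fst
  have hjoint : Measurable fun p : (ℕ → Finset (List A)) × Finset (List A) =>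
      (iterationLaw M idx mle p.2).map (Function.update p.1 (n + 1)) := by
    refine measurable_from_prod_countable_left fun Υ => ?_
    refine Measure.measurable_of_measurable_coe _ fun E hE => ?_
    have hs : SFinite (iterationLaw M idx mle Υ) := by
      unfold iterationLaw; infer_instance
    have := measurable_measure_prodMk_left (ν := iterationLaw M idx mle Υ) (hupd hE)
    convert this using 2 with Ψ
    exact Measure.map_apply (hupd.comp measurable_prodMk_left) hE
  have hext : Measurable fun Ψ : ℕ → Finset (List A) => (Ψ, extend (Ψ n)) :=
    measurable_id.prodMk ((measurable_of_countable extend).comp (measurable_pi_apply n))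
  exact hjoint.comp hext

/-- Success is needed only conditionally on the success of all earlier iterations, so the
conditional bounds multiply. Realizability can thus be restricted to path sets that are covers. -/
theorem pow_le_law (M : EXBMDP S Ξ A X) {N : ℕ} (idx : Finset (List A) → List A → ℕ)
    (mle : Finset (List A) → (Fin N → List A × X) → X → PMF ℕ)
    {P : ℕ → Finset (List A) → Prop} (h0 : P 0 {[]}) {q : ℝ≥0∞} {m : ℕ}
    (hstep : ∀ n < m, ∀ Ψ, P n Ψ → q ≤ iterationLaw M idx mle (extend Ψ) {Φ | P (n + 1) Φ}) :
    q ^ m ≤ law M idx mle m {Ψ | ∀ h ≤ m, P h (Ψ h)} := by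
  have hmeas : ∀ n, MeasurableSet {Ψ : ℕ → Finset (List A) | ∀ h ≤ n, P h (Ψ h)} := by
    intro n
    have : {Ψ : ℕ → Finset (List A) | ∀ h ≤ n, P h (Ψ h)}
        = ⋂ h, ⋂ _ : h ≤ n, Function.eval h ⁻¹' {Φ | P h Φ} := by
      ext Ψ
      simp
    rw [this]
    exact MeasurableSet.iInter fun h => MeasurableSet.iInter fun _ =>
      measurable_pi_apply h (Set.to_countable _).measurableSet
  induction m with
  | zero =>
    rw [law, Measure.dirac_apply' _ (hmeas 0)]
    simp [h0]
  | succ m ih =>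
    have ih' := ih fun n hn => hstep n (hn.trans m.lt_succ_self)
    rw [law, Measure.bind_apply (hmeas _) (measurable_kernel M idx mle m).aemeasurable, pow_succ']
    calc q * q ^ m ≤ q * law M idx mle m {Ψ | ∀ h ≤ m, P h (Ψ h)} := by gcongr
      _ = ∫⁻ _ in {Ψ | ∀ h ≤ m, P h (Ψ h)}, q ∂law M idx mle m := by rw [setLIntegral_const]
      _ ≤ ∫⁻ Ψ in {Ψ | ∀ h ≤ m, P h (Ψ h)},
            ((iterationLaw M idx mle (extend (Ψ m))).map (Function.update Ψ (m + 1)))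
              {Ψ | ∀ h ≤ m + 1, P h (Ψ h)} ∂law M idx mle m := by
          refine setLIntegral_mono' (hmeas m) fun Ψ hΨ => ?_
          refine (hstep m m.lt_succ_self (Ψ m) (hΨ m le_rfl)).trans ?_
          refine (measure_mono ?_).trans
            (Measure.le_map_apply (measurable_of_countable _).aemeasurable _)
          intro Φ hΦ h hh
          rcases hh.eq_or_lt with rfl | hlt
          · simpa using hΦ
          · rw [Function.update_of_ne hlt.ne]
            exact hΨ h (Nat.lt_succ_iff.1 hlt)
      _ ≤ _ := setLIntegral_le_lintegral _ _

/-- One iteration of PPE succeeds with high probability. -/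
theorem le_iterationLaw [Countable Ξ] [Nonempty A] (M : EXBMDP S Ξ A X) {D : EndoMDP S A}
    (hD : D.IsDeterministic) {η : ℝ} (hc : EndoMDP.IsClose η M.endo D) {h : ℕ}
    (hη : ((h : ℝ) + 2) * η ≤ 1 / 4)
    {idx : Finset (List A) → List A → ℕ} (hidx : ∀ Υ, Set.InjOn (idx Υ) (Υ : Set (List A)))
    {F : Finset (X → PMF ℕ)} (hF : ∀ f ∈ F, ∀ i, Measurable fun x => f x i)
    {Ψ : Finset (List A)} (hΨ : D.IsMinimalPolicyCover h Ψ) {g : X → PMF ℕ} (hgF : g ∈ F)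
    (hg : M.IsInverseDynamics (extend Ψ) (idx (extend Ψ)) g) {N : ℕ} (hN : 0 < N)
    {mle : Finset (List A) → (Fin N → List A × X) → X → PMF ℕ} (hmle : IsMLE F idx mle)
    {ε : ℝ} (hε : 0 < ε) (hεΥ : 2 * ε * (extend Ψ).card ≤ 1 / 8) :
    ENNReal.ofReal (1 - (F.card * Real.exp (-(N * ε ^ 2 / 8)) +
          (extend Ψ).card ^ 2 * (2 * Real.exp (-(2 * N * ε ^ 2)))))
      ≤ iterationLaw M idx mle (extend Ψ) {Φ | D.IsMinimalPolicyCover (h + 1) Φ} := by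
  have hΥ := extend_nonempty (hΨ.nonempty hD)
  have hprob := M.isProbabilityMeasure_sampleLaw hΥ
  have hbad := measure_exists_lt_abs_gap_sub_le hΥ (hidx _) hF hgF hg hN hε
  have hκ : (0 : ℝ) < (extend Ψ).card := by exact_mod_cast hΥ.card_pos
  have helim := measurable_eliminate hF hmle (extend Ψ)
  have hgood : MeasurableSet {Φ | D.IsMinimalPolicyCover (h + 1) Φ} :=
    (Set.to_countable _).measurableSet
  rw [iterationLaw, Measure.map_apply helim hgood, ENNReal.ofReal_sub _ (by positivity),
    ENNReal.ofReal_one, tsub_le_iff_right,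
    ← prob_add_prob_compl (μ := Measure.pi fun _ : Fin N => M.sampleLaw (extend Ψ))
      (helim hgood)]
  refine add_le_add_right (le_trans (measure_mono ?_) hbad) _
  intro data hdata
  by_contra hnot
  refine hdata (isMinimalPolicyCover_eliminate hD hΨ (hidx _) ?_)
  intro υ₁ h₁ υ₂ h₂ hne
  have hclose : |gap (mle (extend Ψ) data) data (idx (extend Ψ) υ₁) (idx (extend Ψ) υ₂) -
      ∫ y, |(g y.2 (idx (extend Ψ) υ₁)).toReal - (g y.2 (idx (extend Ψ) υ₂)).toReal|
        ∂M.sampleLaw (extend Ψ)| ≤ 2 * ε := by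
    by_contra hlt
    exact hnot ⟨mle (extend Ψ) data, ((hmle _).1 data).1, ((hmle _).1 data).2 g hgF,
      υ₁, h₁, υ₂, h₂, hne, not_le.1 hlt⟩
  have hclose' := abs_le.1 hclose
  -- The estimation error is at most `1 / (8κ)`. It fits between the mean gap `1 / (2κ)` and the
  -- threshold `5 / (8κ)`, and a fortiori between the threshold and `1 / κ`.
  have hε' : 2 * ε ≤ 1 / 8 / (extend Ψ).card := (le_div_iff₀ hκ).2 hεΥ
  have hlen : ∀ υ ∈ extend Ψ, υ.length = h + 1 := by
    intro υ hυ
    obtain ⟨υ₀, h₀, a, rfl⟩ := mem_extend.1 hυ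
    simp [hΨ.1 υ₀ h₀]
  have hlaw : ∀ υ ∈ extend Ψ, ∀ s, D.pathLaw υ = PMF.pure s →
      1 - 1 / 4 ≤ (M.endo.pathLaw υ s).toReal := by
    intro υ hυ s hs
    have := hc.one_sub_le_pathLaw hD υ hs
    rw [hlen υ hυ] at this
    push_cast at this
    linarith
  obtain ⟨s₁, hs₁⟩ := hD.exists_pathLaw_eq_pure υ₁
  obtain ⟨s₂, hs₂⟩ := hD.exists_pathLaw_eq_pure υ₂
  have e0 : (5 : ℝ) / (8 * (extend Ψ).card) = 5 / 8 / (extend Ψ).card := by rw [div_div]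
  rw [e0]
  constructor
  · intro hle
    by_contra hne'
    have hs : s₁ ≠ s₂ := fun hs => hne' (by rw [hs₁, hs₂, hs])
    have := hg.le_integral_gap (hF g hgF) h₁ h₂ hs (hlaw υ₁ h₁ s₁ hs₁) (hlaw υ₂ h₂ s₂ hs₂)
    have e1 : (2 : ℝ) * (1 - 2 * (1 / 4)) / (extend Ψ).card
        = 5 / 8 / (extend Ψ).card + 1 / 8 / (extend Ψ).card + 1 / 4 / (extend Ψ).card := by ring
    have e2 : (0 : ℝ) < 1 / 4 / (extend Ψ).card := by positivity
    linarith
  · intro heq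
    have := hg.integral_gap_le (hF g hgF) h₁ h₂ ((hlen υ₁ h₁).trans (hlen υ₂ h₂).symm)
      (hlaw υ₁ h₁ s₁ hs₁) (hlaw υ₂ h₂ s₁ (heq.symm.trans hs₁))
    have e1 : (2 : ℝ) * (1 / 4) / (extend Ψ).card + 1 / 8 / (extend Ψ).card
        = 5 / 8 / (extend Ψ).card := by ring
    linarith

end PPE

/-! ### Choice of constants and conclusion -/

/-- With `ε = 1 / (16 * S * A)` and `u = δ / (F * S * A * H)`, the constant `4096 = 2 * 8 * 16 ^ 2`
makes the first exponential at most `u ^ 2`; the second is even at most `u ^ 32`, of which `u ^ 4`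
is used. Each power of `u` absorbs a factor `F` or `K` and leaves at most `δ / H`, which is at most
`1 / 2` as `H ≥ 2`. -/
theorem failure_bound {S A F H K N δ : ℝ} (hS : 1 ≤ S) (hA : 1 ≤ A) (hF : 1 ≤ F) (hH : 2 ≤ H)
    (hδ0 : 0 < δ) (hδ1 : δ < 1) (hK0 : 0 ≤ K) (hK : K ≤ S * A)
    (hN : 4096 * S ^ 2 * A ^ 2 * Real.log (F * S * A * H / δ) ≤ N) :
    F * Real.exp (-(N * (1 / (16 * (S * A))) ^ 2 / 8)) +
      K ^ 2 * (2 * Real.exp (-(2 * N * (1 / (16 * (S * A))) ^ 2))) ≤ δ / H := by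
  have hSA : 1 ≤ S * A := by nlinarith
  have hFSA : 1 ≤ F * (S * A) := by nlinarith
  set u : ℝ := δ / (F * S * A * H) with hu
  have hy : 0 < F * S * A * H / δ := by positivity
  have hu0 : 0 < u := by positivity
  have hlog : Real.log (F * S * A * H / δ) = - Real.log u := by
    rw [← Real.log_inv, hu, inv_div]
  rw [hlog] at hN
  have hlogu : Real.log u ≤ 0 := by
    refine Real.log_nonpos hu0.le ?_
    rw [hu, div_le_one (by positivity)]
    nlinarith
  have e1 : Real.exp (-(N * (1 / (16 * (S * A))) ^ 2 / 8)) ≤ u ^ 2 := by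
    rw [← Real.exp_log hu0, ← Real.exp_nat_mul]
    refine Real.exp_le_exp.2 ?_
    have : 4096 * S ^ 2 * A ^ 2 * -Real.log u * (1 / (16 * (S * A))) ^ 2 / 8
        = -(2 * Real.log u) := by
      field_simp
      ring
    have h2 : 4096 * S ^ 2 * A ^ 2 * -Real.log u * (1 / (16 * (S * A))) ^ 2 / 8
        ≤ N * (1 / (16 * (S * A))) ^ 2 / 8 := by gcongr
    push_cast
    linarith
  have e2 : Real.exp (-(2 * N * (1 / (16 * (S * A))) ^ 2)) ≤ u ^ 4 := by
    rw [← Real.exp_log hu0, ← Real.exp_nat_mul]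
    refine Real.exp_le_exp.2 ?_
    have : 2 * (4096 * S ^ 2 * A ^ 2 * -Real.log u) * (1 / (16 * (S * A))) ^ 2
        = -(32 * Real.log u) := by
      field_simp
      ring
    have h2 : 2 * (4096 * S ^ 2 * A ^ 2 * -Real.log u) * (1 / (16 * (S * A))) ^ 2
        ≤ 2 * N * (1 / (16 * (S * A))) ^ 2 := by gcongr
    push_cast
    linarith
  set v : ℝ := δ / H with hv
  have hv0 : 0 < v := by positivity
  have hvu : v = F * (S * A) * u := by rw [hv, hu]; field_simp
  have hv2 : v ≤ 1 / 2 := by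
    rw [hv, div_le_iff₀ (by positivity)]
    linarith
  have huv : u ≤ v := by rw [hvu]; exact le_mul_of_one_le_left hu0.le hFSA
  have hFu : F * u ≤ v := by
    rw [hvu]
    have : F * u ≤ F * u * (S * A) := le_mul_of_one_le_right (by positivity) hSA
    linarith
  have hKu : K * u ≤ v := by
    rw [hvu]
    have h1 : K * u ≤ S * A * u := by gcongr
    have h2 : S * A * u ≤ F * (S * A * u) := le_mul_of_one_le_left (by positivity) hF
    linarith
  calc _ ≤ F * u ^ 2 + K ^ 2 * (2 * u ^ 4) := by gcongr
    _ = (F * u) * u + 2 * (K * u) ^ 2 * u ^ 2 := by ring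
    _ ≤ v * (1 / 2) + 2 * (1 / 2) ^ 2 * (v * (1 / 2)) := by
        have hKu0 : 0 ≤ K * u := by positivity
        have : u ^ 2 ≤ v * (1 / 2) := by
          rw [sq]; exact mul_le_mul huv (huv.trans hv2) hu0.le hv0.le
        gcongr
        · exact huv.trans hv2
        · exact hKu.trans hv2
    _ ≤ v := by linarith

end

theorem mainTheorem1 :
    ∃ C : ℝ, 0 < C ∧
      ∀ (S Ξ A X : Type*) [Fintype S] [Countable Ξ] [Fintype A] [Nonempty A] [DecidableEq A]
        [MeasurableSpace X] (M : EXBMDP S Ξ A X) (H : ℕ) (_hH : 1 ≤ H)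
        -- the deterministic MDP close to the endogenous dynamics
        (D : EndoMDP S A) (_hD : D.IsDeterministic)
        (η : ℝ) (_hη : η ≤ 1 / (4 * (Fintype.card S : ℝ) * (H : ℝ)))
        (_hclose : EndoMDP.IsClose η M.endo D)
        (δ : ℝ) (_hδ0 : 0 < δ) (_hδ1 : δ < 1)
        -- labels of the paths in each path set
        (idx : Finset (List A) → List A → ℕ) (_hidx : ∀ Υ, Set.InjOn (idx Υ) (Υ : Set (List A)))
        -- the function class, and its realizability
        (F : Finset (X → PMF ℕ)) (_hF : ∀ f ∈ F, ∀ i, Measurable fun x => f x i)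
        (_hreal : ∀ h, h + 1 < H → ∀ Ψ : Finset (List A), Ψ.Nonempty →
          (∀ υ ∈ Ψ, υ.length = h) → Ψ.card ≤ Fintype.card S →
          ∃ f ∈ F, M.IsInverseDynamics (PPE.extend Ψ) (idx (PPE.extend Ψ)) f)
        -- the number of samples in each iteration, and the maximum likelihood solver
        (N : ℕ)
        (_hN : C * (Fintype.card S : ℝ) ^ 2 * (Fintype.card A : ℝ) ^ 2 *
          Real.log ((F.card : ℝ) * (Fintype.card S : ℝ) * (Fintype.card A : ℝ) * (H : ℝ) / δ)
            ≤ (N : ℝ))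
        (mle : Finset (List A) → (Fin N → List A × X) → X → PMF ℕ)
        (_hmle : PPE.IsMLE F idx mle),
        ENNReal.ofReal (1 - δ) < PPE.law M idx mle (H - 1)
          {Ψ | ∀ h < H, D.IsMinimalPolicyCover h (Ψ h) ∧
            M.IsApproxPolicyCover (η * (H : ℝ)) h (Ψ h)} := by
  refine ⟨4096, by norm_num, ?_⟩
  intro S Ξ A X _ _ _ _ _ _ M H hH D hD η hη hclose δ hδ0 hδ1 idx hidx F hF hreal N hN mle hmle
  obtain ⟨s₀, -⟩ := hD.1
  obtain ⟨ξ₀, -⟩ := M.exoInit.support_nonempty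
  have hS : (1 : ℝ) ≤ Fintype.card S := by
    exact_mod_cast (Fintype.card_pos_iff.2 ⟨s₀⟩ : 0 < Fintype.card S)
  have hA : (1 : ℝ) ≤ Fintype.card A := by exact_mod_cast (Fintype.card_pos : 0 < Fintype.card A)
  have hH1 : (1 : ℝ) ≤ H := by exact_mod_cast hH
  have hη4 : η * H ≤ 1 / 4 := by
    have h1 : η * H ≤ 1 / (4 * (Fintype.card S : ℝ) * H) * H := by gcongr
    have h2 : 1 / (4 * (Fintype.card S : ℝ) * H) * H = 1 / (4 * Fintype.card S) := by field_simp
    rw [h2] at h1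
    exact h1.trans (one_div_le_one_div_of_le (by norm_num) (by linarith))
  have hη0 := hclose.nonneg
  have hsub : {Ψ : ℕ → Finset (List A) | ∀ h ≤ H - 1, D.IsMinimalPolicyCover h (Ψ h)} ⊆
      {Ψ | ∀ h < H, D.IsMinimalPolicyCover h (Ψ h) ∧
        M.IsApproxPolicyCover (η * (H : ℝ)) h (Ψ h)} := by
    intro Ψ hΨ h hh
    have := hΨ h (Nat.le_sub_one_of_lt hh)
    exact ⟨this, M.isApproxPolicyCover_of_isMinimalPolicyCover hD hclose hh this⟩
  refine lt_of_lt_of_le ?_ (measure_mono hsub)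
  refine lt_of_lt_of_le ?_ (PPE.pow_le_law M idx mle (EndoMDP.isMinimalPolicyCover_zero hD)
    (q := ENNReal.ofReal (1 - δ / H)) ?_)
  · have hδH : δ / H ≤ 1 := (div_le_one (by positivity)).2 (by linarith)
    rw [← ENNReal.ofReal_pow (by linarith)]
    -- Bernoulli's inequality: there are only `H - 1` iterations, and the spare `δ / H` makes the
    -- final inequality strict, also for `H = 1`.
    have hb := one_add_mul_le_pow (a := -(δ / H)) (by linarith) (H - 1)
    have hcast : ((H - 1 : ℕ) : ℝ) = H - 1 := by rw [Nat.cast_sub hH, Nat.cast_one]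
    have hlt : 1 - δ < (1 - δ / H) ^ (H - 1) := by
      rw [hcast] at hb
      have e : 1 + ((H : ℝ) - 1) * -(δ / H) = 1 - δ + δ / H := by field_simp; ring
      have : 0 < δ / H := by positivity
      rw [← sub_eq_add_neg] at hb
      linarith
    exact (ENNReal.ofReal_lt_ofReal_iff ((sub_pos.2 hδ1).trans hlt)).2 hlt
  · intro n hn Ψ hΨ
    have hnH : n + 2 ≤ H := by omega
    have hnH' : (n : ℝ) + 2 ≤ H := by exact_mod_cast hnH
    obtain ⟨g, hgF, hg⟩ := hreal n (by omega) Ψ (hΨ.nonempty hD) hΨ.1 (hΨ.card_le hD)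
    have hF1 : (1 : ℝ) ≤ F.card := by exact_mod_cast Finset.card_pos.2 ⟨g, hgF⟩
    have hH2 : (2 : ℝ) ≤ H := by linarith [(Nat.cast_nonneg n : (0 : ℝ) ≤ n)]
    have hcard : ((PPE.extend Ψ).card : ℝ) ≤ Fintype.card S * Fintype.card A := by
      exact_mod_cast (PPE.card_extend_le Ψ).trans (Nat.mul_le_mul_right _ (hΨ.card_le hD))
    have hN0 : 0 < N := by
      have hy : 1 < (F.card : ℝ) * Fintype.card S * Fintype.card A * H / δ := by
        rw [one_lt_div hδ0]
        refine hδ1.trans_le ?_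
        exact one_le_mul_of_one_le_of_one_le (one_le_mul_of_one_le_of_one_le
          (one_le_mul_of_one_le_of_one_le hF1 hS) hA) hH1
      have hlog := Real.log_pos hy
      have : (0 : ℝ) < N := lt_of_lt_of_le (by positivity) hN
      exact_mod_cast this
    refine le_trans ?_ (PPE.le_iterationLaw M hD hclose (h := n) ?_ hidx hF hΨ hgF hg hN0 hmle
      (ε := 1 / (16 * (Fintype.card S * Fintype.card A))) (by positivity) ?_)
    · refine ENNReal.ofReal_le_ofReal (sub_le_sub_left ?_ _)
      exact failure_bound hS hA hF1 hH2 hδ0 hδ1 (Nat.cast_nonneg _) hcard hN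
    · nlinarith
    · rw [← mul_div_assoc, div_mul_eq_mul_div, div_le_iff₀ (by positivity)]
      linarith
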